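/- Consider the open, non-preemptive online dial-a-ride problem on the real line with a single server of capacity $c\in\{1,2,3,\dots\}\cup\{\infty\}$. A request sequence is $\sigma=(r_1,\dots,r_n)$, $n\ge 1$, with requests $r_i=(a_i,b_i;t_i)$, $a_i,b_i\in\mathbb{R}$ and $0<t_1<\dots<t_n$; request $r_i$ becomes known at time $t_i$, has to be loaded at $a_i$ at some time not earlier than $t_i$, and has to be transported to $b_i$ and unloaded there (and nowhere else). The server starts at time $0$ in the origin $0$, moves with at most unit speed, and carries at most $c$ requests at a time. Let $\mathrm{Opt}(\sigma)$ be the minimum time by which all requests of $\sigma$ can be served if $\sigma$ is known in advance, and let $\mathrm{Opt}(t)$ be the same quantity for the requests released not later than time $t$. For $\alpha\ge 0$, the algorithm $\mathrm{Lazy}(\alpha)$ works as follows. (i) Whenever a request is released, at time $t$ say, and the server is able to deliver all currently loaded requests and return to the origin by time $\alpha\cdot\mathrm{Opt}(t)$, it aborts what it is doing, delivers all loaded requests and returns to the origin in an optimal (shortest) way, and then is idle; otherwise it continues with its current activity. (ii) Whenever the server is idle at time $t$: if $t<\alpha\cdot\mathrm{Opt}(t)$, it waits at its current position until time $\alpha\cdot\mathrm{Opt}(t)$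 and then is idle again; otherwise, if the set $R_t$ of released but unserved requests is nonempty, it follows a shortest schedule that starts in its current position and serves all requests of $R_t$, and then is idle again. A request released at time $t$ is received before the server makes any decision at time $t$; ties between shortest schedules (or between optimal returns) are broken by an arbitrary fixed deterministic rule that depends only on what is known at that time. Let $\mathrm{Lazy}(\alpha)(\sigma)$ be the time by which all requests of $\sigma$ have been served. The competitive ratio of $\mathrm{Lazy}(\alpha)$ on the line is $\sup_\sigma \mathrm{Lazy}(\alpha)(\sigma)/\mathrm{Opt}(\sigma)$. Let $\varphi=\frac{1+\sqrt5}{2}$. For every $\alpha\ge 0$ with $\alpha\notin(2\varphi/3,\varphi)$, every capacity $c\in\{1,2,3,\dots\}\cup\{\infty\}$ and every tie-breaking rule, the competitive ratio of $\mathrm{Lazy}(\alpha)$ on the line is at least $1+\varphi$. -/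

import Mathlib

namespace DialARide

/-- A transportation request `(a, b; t)` on the real line: it appears at position `a` at its
release time `t` and has to be transported to position `b`. -/
@[ext]
structure Request where
  a : ℝ
  b : ℝ
  t : ℝ

noncomputable instance : DecidableEq Request := Classical.decEq _

/-- A request sequence: release times are positive and strictly increasing. -/
def IsRequestSequence (σ : List Request) : Prop :=
  (∀ r ∈ σ, 0 < r.t) ∧ σ.Pairwise (fun r r' => r.t < r'.t)

/-- The server loads a request at its starting position or unloads it at its destination. -/
inductive Action where
  | load (r : Request)
  | unload (r : Request)

/-- The position where an action takes place. -/
def Action.loc : Action → ℝ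
  | .load r => r.a
  | .unload r => r.b

/-- `Serves c L U S`: a server of capacity `c` that currently carries the requests in `L` can
perform the actions `S` in this order, and by doing so it delivers all requests in `L` and picks
up and delivers all requests in `U` (and no others).  Unloading is possible only at the
destination (no preemption). -/
def Serves (c : ℕ∞) : Finset Request → Finset Request → List Action → Prop
  | L, U, [] => L = ∅ ∧ U = ∅
  | L, U, .load r :: S =>
      r ∈ U ∧ (L.card : ℕ∞) + 1 ≤ c ∧ Serves c (insert r L) (U.erase r) S
  | L, U, .unload r :: S => r ∈ L ∧ Serves c (L.erase r) U S

/-! ### The offline optimum -/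

/-- `Timely x t S`: a server of unit speed that is at position `x` at time `t` can perform the
listed actions at the listed times (waiting where necessary), and no request is loaded before its
release time. -/
def Timely : ℝ → ℝ → List (ℝ × Action) → Prop
  | _, _, [] => True
  | x, t, (τ, A) :: S =>
      t + |A.loc - x| ≤ τ ∧ (∀ r, A = .load r → r.t ≤ τ) ∧ Timely A.loc τ S

/-- The time of the last action of a timed schedule (`t` if there is none). -/
def completion : ℝ → List (ℝ × Action) → ℝ
  | t, [] => t
  | _, (τ, _) :: S => completion τ S

/-- The offline optimum completion time for the set `R` of requests, for a server that starts at
time `0` in the origin `0` and knows all of `R` in advance. -/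
noncomputable def opt (c : ℕ∞) (R : Finset Request) : ℝ :=
  sInf {T | ∃ S : List (ℝ × Action),
    Serves c ∅ R (S.map Prod.snd) ∧ Timely 0 0 S ∧ completion 0 S = T}

/-! ### Shortest schedules, ignoring release times -/

/-- The distance walked when performing the actions `S` without detours, starting from `x`. -/
def walkLength : ℝ → List Action → ℝ
  | _, [] => 0
  | x, A :: S => |A.loc - x| + walkLength A.loc S

/-- The final position when performing the actions `S`, starting from `x`. -/
def endPos : ℝ → List Action → ℝ
  | x, [] => x
  | _, A :: S => endPos A.loc S

/-- The distance walked when performing the actions `S`, starting from `x`, and then returning to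
the origin. -/
def returnLength (x : ℝ) (S : List Action) : ℝ :=
  walkLength x S + |endPos x S|

/-- `S` is a shortest schedule serving all requests in `R` when starting (empty) from `x`. -/
def IsShortestSchedule (c : ℕ∞) (R : Finset Request) (x : ℝ) (S : List Action) : Prop :=
  Serves c ∅ R S ∧ ∀ S', Serves c ∅ R S' → walkLength x S ≤ walkLength x S'

/-- Starting from `x`, performing `S` and then returning to the origin is an optimal way of
delivering all loaded requests `L` and returning to the origin. -/
def IsOptimalReturn (c : ℕ∞) (L : Finset Request) (x : ℝ) (S : List Action) : Prop :=
  Serves c L ∅ S ∧ ∀ S', Serves c L ∅ S' → returnLength x S ≤ returnLength x S'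

/-- Shortest schedules need not be unique.  This is a deterministic rule selecting, from the set
`H` of requests released so far and the current time `t`, a shortest schedule `S(R, x)` for the
unserved requests `R` from the position `x`, and an optimal way to deliver the loaded requests `L`
and return to the origin from the position `x`. -/
structure TieBreaking (c : ℕ∞) where
  sched : (H : Finset Request) → (t : ℝ) → (R : Finset Request) → (x : ℝ) → List Action
  sched_spec : ∀ H t R x, IsShortestSchedule c R x (sched H t R x)
  ret : (H : Finset Request) → (t : ℝ) → (L : Finset Request) → (x : ℝ) → List Action
  ret_spec : ∀ H t L x, IsOptimalReturn c L x (ret H t L x)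

/-! ### The algorithm `Lazy(α)` as an event-driven simulation -/

/-- What the server is currently doing; lists contain the actions that are still to be done. -/
inductive Command where
  | idle
  | waitUntil (τ : ℝ)
  | followSchedule (S : List Action)
  | deliverAndReturn (S : List Action)

/-- A configuration of the system. -/
structure State where
  /-- the current time -/
  time : ℝ
  /-- the current position of the server -/
  pos : ℝ
  /-- requests currently carried by the server -/
  loaded : Finset Request
  /-- released requests that have not been loaded yet -/
  pending : Finset Request
  /-- all requests released so far -/
  released : Finset Request
  /-- requests that are still to be released -/
  future : List Request
  /-- the current command -/
  cmd : Command

/-- At the beginning, the server is idle in the origin. -/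
def State.init (σ : List Request) : State where
  time := 0
  pos := 0
  loaded := ∅
  pending := ∅
  released := ∅
  future := σ
  cmd := .idle

/-- The point that a server in position `x` is currently moving to. -/
def Command.heading (x : ℝ) : Command → ℝ
  | .idle => x
  | .waitUntil _ => x
  | .followSchedule [] => x
  | .followSchedule (A :: _) => A.loc
  | .deliverAndReturn [] => 0
  | .deliverAndReturn (A :: _) => A.loc

/-- The position after moving from `x` in the direction of `y` for `d` time units, stopping
at `y`. -/
noncomputable def moveToward (x y d : ℝ) : ℝ := x + max (-d) (min d (y - x))

/-- The server arrives at the location of the action `A`, performs it, and then continues with the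
command `next`. -/
noncomputable def State.perform (s : State) (A : Action) (next : Command) : State :=
  { s with
    time := s.time + |A.loc - s.pos|
    pos := A.loc
    loaded := match A with
      | .load r => insert r s.loaded
      | .unload r => s.loaded.erase r
    pending := match A with
      | .load r => s.pending.erase r
      | .unload _ => s.pending
    cmd := next }

/-- The time of the next event caused by the server itself, if no request is released before;
`⊤` if the server is idle and has nothing to do. -/
noncomputable def State.nextEvent (c : ℕ∞) (α : ℝ) (s : State) : WithTop ℝ :=
  match s.cmd with
  | .idle => if s.time < α * opt c s.released ∨ s.pending.Nonempty then s.time else ⊤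
  | .waitUntil τ => τ
  | .followSchedule S =>
      ((s.time + |(Command.followSchedule S).heading s.pos - s.pos| : ℝ) : WithTop ℝ)
  | .deliverAndReturn S =>
      ((s.time + |(Command.deliverAndReturn S).heading s.pos - s.pos| : ℝ) : WithTop ℝ)

/-- The next event caused by the server itself.  An idle server waits until time `α * Opt(t)`;
if this time has passed, it starts a shortest schedule for the unserved requests, if there are
any.  (The server carries nothing when it is idle, so the unserved requests are the pending
ones.) -/
noncomputable def State.act {c : ℕ∞} (α : ℝ) (B : TieBreaking c) (s : State) : State :=
  match s.cmd with
  | .idle =>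
      if s.time < α * opt c s.released then
        { s with cmd := .waitUntil (α * opt c s.released) }
      else if s.pending.Nonempty then
        { s with cmd := .followSchedule (B.sched s.released s.time s.pending s.pos) }
      else s
  | .waitUntil τ => { s with time := τ, cmd := .idle }
  | .followSchedule [] => { s with cmd := .idle }
  | .followSchedule (A :: S) => s.perform A (.followSchedule S)
  | .deliverAndReturn [] => { s with time := s.time + |s.pos|, pos := 0, cmd := .idle }
  | .deliverAndReturn (A :: S) => s.perform A (.deliverAndReturn S)

/-- The server proceeds with its current command until the release time of `r`, at which `r`
becomes known. -/
noncomputable def State.release (s : State) (r : Request) (fut : List Request) : State :=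
  { s with
    time := r.t
    pos := moveToward s.pos (s.cmd.heading s.pos) (r.t - s.time)
    pending := insert r s.pending
    released := insert r s.released
    future := fut }

/-- Reaction to a new request: if the server can deliver all loaded requests and return to the
origin until time `α * Opt(t)`, it does so, aborting its current command. -/
noncomputable def State.react {c : ℕ∞} (α : ℝ) (B : TieBreaking c) (s : State) : State :=
  let S := B.ret s.released s.time s.loaded s.pos
  if s.time + returnLength s.pos S ≤ α * opt c s.released then
    { s with cmd := .deliverAndReturn S }
  else s

/-- One step of `Lazy(α)`: the next release of a request or the next event of the server is
processed, whichever comes first; releases have priority. -/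
noncomputable def State.step {c : ℕ∞} (α : ℝ) (B : TieBreaking c) (s : State) : State :=
  match s.future with
  | [] => s.act α B
  | r :: fut =>
      if (r.t : WithTop ℝ) ≤ s.nextEvent c α then (s.release r fut).react α B
      else s.act α B

/-- All requests have been released and served. -/
def State.Completed (s : State) : Prop :=
  s.future = [] ∧ s.pending = ∅ ∧ s.loaded = ∅

/-- The completion time of `Lazy(α)` on the request sequence `σ`
(`∞` if not all requests are ever served). -/
noncomputable def lazyTime {c : ℕ∞} (α : ℝ) (B : TieBreaking c) (σ : List Request) : ENNReal :=
  ⨅ (n : ℕ) (_ : ((State.step α B)^[n] (State.init σ)).Completed),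
    ENNReal.ofReal ((State.step α B)^[n] (State.init σ)).time

/-- The strict competitive ratio `sup_σ Lazy(α)(σ) / Opt(σ)` on the line, over all (nonempty)
request sequences. -/
noncomputable def competitiveRatio {c : ℕ∞} (α : ℝ) (B : TieBreaking c) : ENNReal :=
  ⨆ (σ : List Request) (_ : IsRequestSequence σ) (_ : σ ≠ []),
    lazyTime α B σ / ENNReal.ofReal (opt c σ.toFinset)

/-! ### Tie-breaking rules exist -/

theorem finite_serves (c : ℕ∞) (n : ℕ) : ∀ L U : Finset Request, L.card + 2 * U.card ≤ n →
    {S | Serves c L U S}.Finite := by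
  induction n with
  | zero =>
    intro L U h
    have hL : L = ∅ := Finset.card_eq_zero.1 (by omega)
    have hU : U = ∅ := Finset.card_eq_zero.1 (by omega)
    subst hL hU
    refine (Set.finite_singleton []).subset ?_
    rintro (_ | ⟨_ | _, S⟩) h <;> simp_all [Serves]
  | succ n ih =>
    intro L U h
    have h1 : (⋃ r ∈ U, (fun S => Action.load r :: S) ''
        {S | Serves c (insert r L) (U.erase r) S}).Finite := by
      refine U.finite_toSet.biUnion fun r hr => (ih _ _ ?_).image _
      have := Finset.card_insert_le r L
      have := Finset.card_erase_add_one (Finset.mem_coe.1 hr)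
      omega
    have h2 : (⋃ r ∈ L, (fun S => Action.unload r :: S) ''
        {S | Serves c (L.erase r) U S}).Finite := by
      refine L.finite_toSet.biUnion fun r hr => (ih _ _ ?_).image _
      have := Finset.card_erase_add_one (Finset.mem_coe.1 hr)
      omega
    refine (((Set.finite_singleton []).union h1).union h2).subset ?_
    rintro (_ | ⟨r | r, S⟩) hS
    · simp
    · left; right
      simp only [Set.mem_iUnion]
      exact ⟨r, hS.1, S, hS.2.2, rfl⟩
    · right
      simp only [Set.mem_iUnion]
      exact ⟨r, hS.1, S, hS.2, rfl⟩

theorem exists_serves {c : ℕ∞} (hc : 1 ≤ c) (R : Finset Request) : ∃ S, Serves c ∅ R S := by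
  induction R using Finset.induction_on with
  | empty => exact ⟨[], rfl, rfl⟩
  | insert r R hr ih =>
    obtain ⟨S, hS⟩ := ih
    refine ⟨.load r :: .unload r :: S, by simp, by simpa using hc, by simp, ?_⟩
    simpa [Finset.erase_insert hr] using hS

theorem exists_serves_loaded (c : ℕ∞) (L : Finset Request) : ∃ S, Serves c L ∅ S := by
  induction L using Finset.induction_on with
  | empty => exact ⟨[], rfl, rfl⟩
  | insert r L hr ih =>
    obtain ⟨S, hS⟩ := ih
    refine ⟨.unload r :: S, by simp, ?_⟩
    simpa [Finset.erase_insert hr] using hS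

/-- Shortest schedules and optimal returns always exist. -/
theorem TieBreaking.nonempty {c : ℕ∞} (hc : 1 ≤ c) : Nonempty (TieBreaking c) := by
  have h1 : ∀ R x, ∃ S, IsShortestSchedule c R x S := fun R x =>
    (Set.exists_min_image _ (walkLength x) (finite_serves c _ ∅ R le_rfl) (exists_serves hc R))
  have h2 : ∀ L x, ∃ S, IsOptimalReturn c L x S := fun L x =>
    (Set.exists_min_image _ (returnLength x) (finite_serves c _ L ∅ le_rfl)
      (exists_serves_loaded c L))
  choose f hf using h1
  choose g hg using h2
  exact ⟨⟨fun _ _ => f, fun _ _ => hf, fun _ _ => g, fun _ _ => hg⟩⟩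

end DialARide

namespace DialARide

variable {c : ℕ∞} {α : ℝ} {B : TieBreaking c}

/-! ### Lower bounds on the completion time of a run -/

/-- Every completed state of the run of `Lazy(α)` from `s` has time at least `X`. -/
def CompletesAfter (α : ℝ) (B : TieBreaking c) (s : State) (X : ℝ) : Prop :=
  ∀ n, ((State.step α B)^[n] s).Completed → X ≤ ((State.step α B)^[n] s).time

theorem CompletesAfter.of_step {s : State} {X : ℝ} (hs : ¬ s.Completed)
    (h : CompletesAfter α B (s.step α B) X) : CompletesAfter α B s X := by
  rintro (_ | n) hn
  · exact absurd hn hs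
  · rw [Function.iterate_succ_apply] at hn ⊢
    exact h n hn

theorem CompletesAfter.le_lazyTime {σ : List Request} {X : ℝ}
    (h : CompletesAfter α B (State.init σ) X) : ENNReal.ofReal X ≤ lazyTime α B σ :=
  le_iInf₂ fun n hn => ENNReal.ofReal_le_ofReal (h n hn)

theorem completesAfter_of_le_time {s : State} {X : ℝ} (hf : s.future = [])
    (hw : ∀ τ, s.cmd = .waitUntil τ → s.time ≤ τ) (hX : X ≤ s.time) :
    CompletesAfter α B s X := by
  have key : ∀ n, ((State.step α B)^[n] s).future = [] ∧
      (∀ τ, ((State.step α B)^[n] s).cmd = .waitUntil τ → ((State.step α B)^[n] s).time ≤ τ) ∧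
      X ≤ ((State.step α B)^[n] s).time := by
    intro n
    induction n with
    | zero => exact ⟨hf, hw, hX⟩
    | succ n ih =>
      rw [Function.iterate_succ_apply']
      generalize (State.step α B)^[n] s = s' at ih
      obtain ⟨time, pos, loaded, pending, released, future, cmd⟩ := s'
      obtain ⟨h1, h2, h3⟩ := ih
      simp only at h1 h2 h3
      subst h1
      rcases cmd with _ | τ | (_ | ⟨A, S⟩) | (_ | ⟨A, S⟩)
      · simp only [State.step, State.act]
        split_ifs with h4 h5
        · refine ⟨rfl, fun τ hτ => ?_, h3⟩
          simp only [Command.waitUntil.injEq] at hτ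
          simpa [← hτ] using h4.le
        · exact ⟨rfl, fun τ hτ => by simp at hτ, h3⟩
        · exact ⟨rfl, fun τ hτ => by simp at hτ, h3⟩
      · exact ⟨rfl, fun τ hτ => by simp [State.step, State.act] at hτ, h3.trans (h2 τ rfl)⟩
      · exact ⟨rfl, fun τ hτ => by simp [State.step, State.act] at hτ, h3⟩
      · refine ⟨rfl, fun τ hτ => by simp [State.step, State.act, State.perform] at hτ, ?_⟩
        exact h3.trans (le_add_of_nonneg_right (abs_nonneg _))
      · refine ⟨rfl, fun τ hτ => by simp [State.step, State.act] at hτ, ?_⟩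
        exact h3.trans (le_add_of_nonneg_right (abs_nonneg _))
      · refine ⟨rfl, fun τ hτ => by simp [State.step, State.act, State.perform] at hτ, ?_⟩
        exact h3.trans (le_add_of_nonneg_right (abs_nonneg _))
  exact fun n _ => (key n).2.2

theorem State.step_eq_act {s : State} (h : ∀ r ∈ s.future.head?, s.nextEvent c α < (r.t : WithTop ℝ)) :
    s.step α B = s.act α B := by
  unfold State.step
  split
  · rfl
  · rename_i r fut hr
    rw [if_neg (not_le.2 (h r (by simp [hr])))]

theorem State.step_eq_release {s : State} {r : Request} {fut : List Request}
    (hf : s.future = r :: fut) (h : (r.t : WithTop ℝ) ≤ s.nextEvent c α) :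
    s.step α B = (s.release r fut).react α B := by
  unfold State.step
  rw [hf]
  simp only [if_pos h]

theorem State.not_completed_of_future {s : State} {r : Request} {fut : List Request}
    (hf : s.future = r :: fut) : ¬ s.Completed := fun h => by
  have := h.1
  simp [hf] at this

theorem State.not_completed_of_pending {s : State} (h : s.pending.Nonempty) : ¬ s.Completed :=
  fun h' => h.ne_empty h'.2.1

/-! ### Returns to the origin -/

theorem serves_empty {S : List Action} (h : Serves c ∅ ∅ S) : S = [] := by
  rcases S with _ | ⟨_ | _, S⟩ <;> simp_all [Serves]

theorem abs_le_returnLength (S : List Action) (x : ℝ) : |x| ≤ returnLength x S := by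
  induction S generalizing x with
  | nil => simp [returnLength, walkLength, endPos]
  | cons A S ih =>
    have h := ih A.loc
    simp only [returnLength, walkLength, endPos] at h ⊢
    have := abs_sub_abs_le_abs_sub x A.loc
    rw [abs_sub_comm] at this
    linarith

theorem loaded_le_returnLength {S : List Action} {L U : Finset Request} {x : ℝ} {r : Request}
    (hS : Serves c L U S) (hr : r ∈ L) : |r.b - x| + |r.b| ≤ returnLength x S := by
  induction S generalizing x L U with
  | nil => simp [hS.1] at hr
  | cons A S ih =>
    have step : ∀ y, |r.b - y| + |r.b| ≤ returnLength y S →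
        |r.b - x| + |r.b| ≤ |y - x| + returnLength y S := fun y hy => by
      have := abs_sub_le r.b y x
      linarith
    have unf : returnLength x (A :: S) = |A.loc - x| + returnLength A.loc S := by
      simp only [returnLength, walkLength, endPos]; ring
    rw [unf]
    cases A with
    | load r' => exact step _ (ih hS.2.2 (by simp [hr]))
    | unload r' =>
      by_cases h : r = r'
      · subst h
        have := abs_le_returnLength S r.b
        simp only [Action.loc]
        linarith
      · exact step _ (ih hS.2 (by simp [hr, h]))

/-- The server cannot deliver what it carries and be back in the origin before time `K`,
neither now nor later. -/
def Far (K : ℝ) (s : State) : Prop :=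
  K ≤ s.time + |s.pos| ∨ ∃ r ∈ s.loaded, K ≤ s.time + |r.b - s.pos| + |r.b|

theorem Far.le_returnLength {K : ℝ} {s : State} (h : Far K s) {S : List Action}
    (hS : Serves c s.loaded ∅ S) : K ≤ s.time + returnLength s.pos S := by
  rcases h with h | ⟨r, hr, h⟩
  · have := abs_le_returnLength S s.pos
    linarith
  · have := loaded_le_returnLength (x := s.pos) hS hr
    linarith

theorem Far.react {K : ℝ} {s : State} (h : Far K s) (hK : α * opt c s.released < K) :
    s.react α B = s := by
  unfold State.react
  have := h.le_returnLength (B.ret_spec s.released s.time s.loaded s.pos).1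
  exact if_neg (by linarith)

theorem Far.move {K : ℝ} {s s' : State} (h : Far K s) (hl : s'.loaded = s.loaded)
    (hd : |s'.pos - s.pos| ≤ s'.time - s.time) : Far K s' := by
  rcases h with h | ⟨r, hr, h⟩
  · left
    have := abs_sub_abs_le_abs_sub s.pos s'.pos
    rw [abs_sub_comm] at this
    linarith
  · right
    refine ⟨r, hl ▸ hr, ?_⟩
    have := abs_sub_le r.b s'.pos s.pos
    linarith

theorem Far.perform {K : ℝ} {s : State} (h : Far K s) (A : Action) (C : Command) :
    Far K (s.perform A C) := by
  rcases h with h | ⟨r, hr, h⟩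
  · left
    have := abs_sub_abs_le_abs_sub s.pos A.loc
    rw [abs_sub_comm] at this
    simp only [State.perform]
    linarith
  · have tri := abs_sub_le r.b A.loc s.pos
    by_cases hA : A = .unload r
    · subst hA
      left
      simpa [State.perform, Action.loc] using h
    · right
      refine ⟨r, ?_, by simp only [State.perform]; linarith⟩
      cases A with
      | load r' => simp [State.perform, hr]
      | unload r' =>
        simp only [State.perform, Finset.mem_erase]
        exact ⟨fun h => hA (by rw [h]), hr⟩

/-! ### Following a schedule -/

/-- In the state `s` the server follows the schedule `S`, which serves the pending requests `U`
but not the pending requests `V`; it will be done at time `F` in position `e`. -/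
structure Following (c : ℕ∞) (s : State) (S : List Action) (U V : Finset Request) (F e : ℝ) :
    Prop where
  cmd : s.cmd = .followSchedule S
  serves : Serves c s.loaded U S
  pending : s.pending = U ∪ V
  disj : Disjoint U V
  sub : U ⊆ s.released
  finish : s.time + walkLength s.pos S = F
  last : endPos s.pos S = e

theorem Following.perform {s : State} {A : Action} {S : List Action} {U V : Finset Request}
    {F e : ℝ} (h : Following c s (A :: S) U V F e) :
    ∃ U', Following c (s.perform A (.followSchedule S)) S U' V F e := by
  have hF := h.finish
  have he := h.last
  have hp := h.pending
  have hd := h.disj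
  have hs := h.serves
  simp only [walkLength, endPos] at hF he
  cases A with
  | load r =>
    obtain ⟨h1, -, h3⟩ := hs
    refine ⟨U.erase r, rfl, h3, ?_, hd.mono_left (Finset.erase_subset _ _),
      (Finset.erase_subset _ _).trans h.sub, ?_, he⟩
    · simp only [State.perform, hp]
      rw [Finset.erase_union_distrib, Finset.erase_eq_of_notMem (s := V)]
      exact Finset.disjoint_left.1 hd h1
    · simp only [State.perform]; linarith
  | unload r =>
    refine ⟨U, rfl, hs.2, hp, hd, h.sub, ?_, he⟩
    simp only [State.perform]; linarith

theorem walkLength_nonneg (x : ℝ) (S : List Action) : 0 ≤ walkLength x S := by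
  induction S generalizing x with
  | nil => exact le_rfl
  | cons A S ih => exact add_nonneg (abs_nonneg _) (ih _)

theorem moveToward_spec {x y d : ℝ} (h0 : 0 ≤ d) (h : d ≤ |y - x|) :
    |moveToward x y d - x| ≤ d ∧ |y - moveToward x y d| = |y - x| - d := by
  unfold moveToward
  rcases le_total 0 (y - x) with hy | hy
  · rw [abs_of_nonneg hy] at h ⊢
    rw [min_eq_left h, max_eq_right (by linarith)]
    constructor
    · rw [add_sub_cancel_left, abs_of_nonneg h0]
    · rw [abs_of_nonneg (by linarith)]; ring
  · rw [abs_of_nonpos hy] at h ⊢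
    rw [min_eq_right (by linarith), max_eq_left (by linarith)]
    constructor
    · rw [add_sub_cancel_left, abs_neg, abs_of_nonneg h0]
    · rw [abs_of_nonpos (by linarith)]; ring

/-- The server follows its schedule until it is done. -/
theorem Following.completesAfter {s : State} {S : List Action} {U V : Finset Request}
    {F e X : ℝ} (h : Following c s S U V F e) (hV : V.Nonempty) (hf : ∀ r ∈ s.future.head?, F < r.t)
    (hX : CompletesAfter α B ⟨F, e, ∅, V, s.released, s.future, .idle⟩ X) :
    CompletesAfter α B s X := by
  induction S generalizing s U with
  | nil =>
    have hne : s.nextEvent c α = (F : WithTop ℝ) := by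
      have := h.finish
      simp only [walkLength, add_zero] at this
      simp [State.nextEvent, h.cmd, Command.heading, this]
    refine CompletesAfter.of_step (State.not_completed_of_pending ?_) ?_
    · rw [h.pending]; exact hV.mono Finset.subset_union_right
    rw [State.step_eq_act (fun r hr => by rw [hne]; exact_mod_cast hf r hr)]
    convert hX using 1
    have h1 := h.finish
    have h2 := h.last
    have h3 := h.serves
    have h4 := h.pending
    have h5 := h.cmd
    obtain ⟨time, pos, loaded, pending, released, future, cmd⟩ := s
    simp only [walkLength, add_zero, endPos, Serves] at h1 h2 h3 h4 h5
    simp [State.act, h1, h2, h3, h4, h5]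
  | cons A S ih =>
    have hne : s.nextEvent c α = ((s.time + |A.loc - s.pos| : ℝ) : WithTop ℝ) := by
      simp [State.nextEvent, h.cmd, Command.heading]
    have hF := h.finish
    have := walkLength_nonneg A.loc S
    simp only [walkLength] at hF
    refine CompletesAfter.of_step (State.not_completed_of_pending ?_) ?_
    · rw [h.pending]; exact hV.mono Finset.subset_union_right
    rw [State.step_eq_act (fun r hr => by
      rw [hne]; exact_mod_cast lt_of_le_of_lt (by linarith) (hf r hr))]
    obtain ⟨U', hU'⟩ := h.perform
    have hact : s.act α B = s.perform A (.followSchedule S) := by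
      simp [State.act, h.cmd]
    rw [hact]
    exact ih hU' hf hX

/-- The server follows its schedule until the end of the run. -/
theorem Following.completesAfter_finish {s : State} {S : List Action} {U : Finset Request}
    {F e : ℝ} (h : Following c s S U ∅ F e) (hf : s.future = []) : CompletesAfter α B s F := by
  induction S generalizing s U with
  | nil =>
    refine completesAfter_of_le_time hf (fun τ hτ => by simp [h.cmd] at hτ) ?_
    have := h.finish
    simp only [walkLength, add_zero] at this
    exact this.ge
  | cons A S ih =>
    refine CompletesAfter.of_step (fun hc => ?_) ?_
    · have h1 := h.pending
      rw [hc.2.1, Finset.union_empty] at h1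
      have h2 := h.serves
      rw [hc.2.2, ← h1] at h2
      simpa using serves_empty h2
    rw [State.step_eq_act (by simp [hf])]
    obtain ⟨U', hU'⟩ := h.perform
    have hact : s.act α B = s.perform A (.followSchedule S) := by
      simp [State.act, h.cmd]
    rw [hact]
    exact ih hU' hf

/-- A request is released while the server follows a schedule, and the server cannot return. -/
theorem Following.completesAfter_release {s : State} {S : List Action} {U V : Finset Request}
    {F e K X : ℝ} {r : Request} {fut : List Request} (h : Following c s S U V F e)
    (hf : s.future = r :: fut) (ht : s.time ≤ r.t) (hrF : r.t < F)
    (hfar : Far K s) (hK : α * opt c (insert r s.released) < K) (hr : r ∉ s.released)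
    (hX : ∀ s' S' U', Following c s' S' U' (insert r V) F e → s'.future = fut → s'.time = r.t →
      s'.released = insert r s.released → Far K s' → CompletesAfter α B s' X) :
    CompletesAfter α B s X := by
  induction S generalizing s U with
  | nil =>
    have := h.finish
    simp only [walkLength, add_zero] at this
    linarith
  | cons A S ih =>
    have hne : s.nextEvent c α = ((s.time + |A.loc - s.pos| : ℝ) : WithTop ℝ) := by
      simp [State.nextEvent, h.cmd, Command.heading]
    refine CompletesAfter.of_step (State.not_completed_of_future hf) ?_
    rcases le_or_gt r.t (s.time + |A.loc - s.pos|) with hle | hlt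
    · rw [State.step_eq_release hf (by rw [hne]; exact_mod_cast hle)]
      obtain ⟨m1, m2⟩ := moveToward_spec (x := s.pos) (y := A.loc) (d := r.t - s.time)
        (by linarith) (by linarith)
      have hpos : (s.release r fut).pos = moveToward s.pos A.loc (r.t - s.time) := by
        simp [State.release, h.cmd, Command.heading]
      have hfar' : Far K (s.release r fut) := hfar.move rfl (by rw [hpos]; exact m1)
      rw [hfar'.react hK]
      refine hX _ (A :: S) U ⟨h.cmd, h.serves, ?_, ?_, ?_, ?_, h.last⟩ rfl rfl rfl hfar'
      · simp [State.release, h.pending]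
      · rw [Finset.disjoint_insert_right]
        exact ⟨fun hU => hr (h.sub hU), h.disj⟩
      · exact h.sub.trans (Finset.subset_insert _ _)
      · have := h.finish
        simp only [walkLength] at this ⊢
        rw [hpos, m2]
        simp only [State.release]
        linarith
    · rw [State.step_eq_act (fun r' hr' => ?_)]
      · obtain ⟨U', hU'⟩ := h.perform
        have hact : s.act α B = s.perform A (.followSchedule S) := by
          simp [State.act, h.cmd]
        rw [hact]
        exact ih hU' hf hlt.le (hfar.perform _ _) hK hr hX
      · simp only [hf, List.head?_cons, Option.mem_def, Option.some.injEq] at hr'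
        rw [hne, ← hr']
        exact_mod_cast hlt

/-! ### Starting a schedule -/

theorem completesAfter_idle {t p X : ℝ} {V H : Finset Request} {fut : List Request}
    (ht : α * opt c H ≤ t) (hV : V.Nonempty) (hf : ∀ r ∈ fut.head?, t < r.t)
    (hX : CompletesAfter α B ⟨t, p, ∅, V, H, fut, .followSchedule (B.sched H t V p)⟩ X) :
    CompletesAfter α B ⟨t, p, ∅, V, H, fut, .idle⟩ X := by
  refine CompletesAfter.of_step (State.not_completed_of_pending hV) ?_
  rw [State.step_eq_act fun r hr => ?_]
  · simpa [State.act, not_lt.2 ht, hV] using hX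
  · simp only [State.nextEvent, hV, or_true, if_true]
    exact_mod_cast hf r hr

theorem following_sched {t p : ℝ} {V H : Finset Request} {fut : List Request} (hVH : V ⊆ H) :
    Following c ⟨t, p, ∅, V, H, fut, .followSchedule (B.sched H t V p)⟩ (B.sched H t V p) V ∅
      (t + walkLength p (B.sched H t V p)) (endPos p (B.sched H t V p)) :=
  ⟨rfl, (B.sched_spec H t V p).1, by simp, by simp, hVH, rfl, rfl⟩

/-- An idle server starts a schedule by loading a request in its current position. -/
theorem completesAfter_idle_load {t p X : ℝ} {V H : Finset Request} {fut : List Request}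
    {r : Request} {S : List Action} (hVH : V ⊆ H)
    (ht : α * opt c H ≤ t) (hV : V.Nonempty) (hf : ∀ r ∈ fut.head?, t < r.t) (hf' : fut ≠ [])
    (hS : B.sched H t V p = .load r :: S) (hr : r.a = p)
    (hX : ∀ s U, Following c s S U ∅ (t + walkLength p (B.sched H t V p))
      (endPos p (B.sched H t V p)) → s.future = fut → s.time = t → s.released = H →
      Far (t + |r.b - r.a| + |r.b|) s → CompletesAfter α B s X) :
    CompletesAfter α B ⟨t, p, ∅, V, H, fut, .idle⟩ X := by
  refine completesAfter_idle ht hV hf ?_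
  have h := following_sched (B := B) (t := t) (p := p) (fut := fut) hVH
  rw [hS] at h hX ⊢
  obtain ⟨U, hU⟩ := h.perform
  obtain ⟨r', fut, rfl⟩ := List.exists_cons_of_ne_nil hf'
  refine CompletesAfter.of_step (State.not_completed_of_future rfl) ?_
  rw [State.step_eq_act fun r'' hr'' => ?_]
  · refine hX _ U hU rfl ?_ rfl (Or.inr ⟨r, ?_, ?_⟩)
    · simp [State.act, State.perform, Action.loc, hr]
    · simp [State.act, State.perform]
    · simp [State.act, State.perform, Action.loc, hr]
  · simpa [State.nextEvent, Command.heading, Action.loc, hr] using hf _ hr''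

/-- After the last release, an idle server serves all pending requests. -/
theorem completesAfter_idle_last {t p d : ℝ} {V H : Finset Request} (hVH : V ⊆ H)
    (hV : V.Nonempty) (hd : ∀ S, Serves c ∅ V S → d ≤ walkLength p S) :
    CompletesAfter α B ⟨t, p, ∅, V, H, [], .idle⟩ (t + d) := by
  have main : ∀ t', t ≤ t' → α * opt c H ≤ t' →
      CompletesAfter α B ⟨t', p, ∅, V, H, [], .idle⟩ (t + d) := by
    intro t' ht' hop
    refine completesAfter_idle hop hV (by simp) fun n hn => ?_
    have := (following_sched hVH).completesAfter_finish (α := α) (B := B) rfl n hn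
    have := hd _ (B.sched_spec H t' V p).1
    linarith
  rcases le_or_gt (α * opt c H) t with h | h
  · exact main t le_rfl h
  · refine CompletesAfter.of_step (State.not_completed_of_pending hV) ?_
    rw [State.step_eq_act (by simp)]
    simp only [State.act, h, if_true]
    refine CompletesAfter.of_step (State.not_completed_of_pending hV) ?_
    rw [State.step_eq_act (by simp)]
    exact main _ h.le le_rfl

/-! ### Waiting in the origin -/

theorem moveToward_self {x d : ℝ} (h : 0 ≤ d) : moveToward x x d = x := by
  simp [moveToward, h]

theorem completesAfter_release_origin {s : State} {r : Request} {fut : List Request} {X : ℝ}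
    (hf : s.future = r :: fut) (hn : (r.t : WithTop ℝ) ≤ s.nextEvent c α) (hl : s.loaded = ∅)
    (hh : s.cmd.heading 0 = 0) (hp : s.pos = 0) (ht : s.time ≤ r.t)
    (hr : r.t < α * opt c (insert r s.released)) (hf' : ∀ r' ∈ fut.head?, r.t < r'.t)
    (hX : CompletesAfter α B ⟨r.t, 0, ∅, insert r s.pending, insert r s.released, fut,
      .waitUntil (α * opt c (insert r s.released))⟩ X) :
    CompletesAfter α B s X := by
  refine CompletesAfter.of_step (State.not_completed_of_future hf) ?_
  rw [State.step_eq_release hf hn]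
  have hrel : s.release r fut =
      ⟨r.t, 0, ∅, insert r s.pending, insert r s.released, fut, s.cmd⟩ := by
    simp [State.release, hp, hh, hl, moveToward_self (sub_nonneg.2 ht)]
  have hret : B.ret (insert r s.released) r.t ∅ 0 = [] :=
    serves_empty (B.ret_spec (insert r s.released) r.t ∅ 0).1
  rw [hrel]
  have hne : (insert r s.pending).Nonempty := Finset.insert_nonempty _ _
  simp only [State.react, hret, returnLength, walkLength, endPos, abs_zero, add_zero, hr.le,
    if_true]
  refine CompletesAfter.of_step (State.not_completed_of_pending hne) ?_
  rw [State.step_eq_act fun r' hr' => ?_]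
  · refine CompletesAfter.of_step (State.not_completed_of_pending hne) ?_
    rw [State.step_eq_act fun r' hr' => ?_]
    · simpa [State.act, hr] using hX
    · simpa [State.act, State.nextEvent, hne] using hf' r' hr'
  · simpa [State.nextEvent, Command.heading] using hf' r' hr'

theorem opt_empty : opt c ∅ = 0 := by
  have : {T | ∃ S : List (ℝ × Action),
      Serves c ∅ ∅ (S.map Prod.snd) ∧ Timely 0 0 S ∧ completion 0 S = T} = {0} := by
    ext T
    constructor
    · rintro ⟨S, h1, -, h3⟩
      have := serves_empty h1
      simp only [List.map_eq_nil_iff] at this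
      subst this
      exact h3.symm
    · rintro rfl
      exact ⟨[], ⟨rfl, rfl⟩, trivial, rfl⟩
  rw [opt, this, csInf_singleton]

theorem nextEvent_init (σ : List Request) : (State.init σ).nextEvent c α = ⊤ := by
  simp [State.nextEvent, State.init, opt_empty]

theorem completesAfter_init {r : Request} {fut : List Request} {X : ℝ} (h0 : 0 < r.t)
    (hr : r.t < α * opt c {r}) (hf : ∀ r' ∈ fut.head?, r.t < r'.t)
    (hX : CompletesAfter α B ⟨r.t, 0, ∅, {r}, {r}, fut, .waitUntil (α * opt c {r})⟩ X) :
    CompletesAfter α B (State.init (r :: fut)) X :=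
  completesAfter_release_origin rfl (by simp [nextEvent_init]) rfl rfl rfl h0.le hr hf hX

theorem completesAfter_wait_release {t τ X : ℝ} {H : Finset Request} {r : Request}
    {fut : List Request} (ht : t ≤ r.t) (hτ : r.t ≤ τ) (hr : r.t < α * opt c (insert r H))
    (hf : ∀ r' ∈ fut.head?, r.t < r'.t)
    (hX : CompletesAfter α B ⟨r.t, 0, ∅, insert r H, insert r H, fut,
      .waitUntil (α * opt c (insert r H))⟩ X) :
    CompletesAfter α B ⟨t, 0, ∅, H, H, r :: fut, .waitUntil τ⟩ X :=
  completesAfter_release_origin rfl (by simpa [State.nextEvent] using hτ) rfl rfl rfl ht hr hf hX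

theorem completesAfter_wait {t τ X : ℝ} {H : Finset Request} {fut : List Request}
    (hH : H.Nonempty) (hf : ∀ r ∈ fut.head?, τ < r.t)
    (hX : CompletesAfter α B ⟨τ, 0, ∅, H, H, fut, .idle⟩ X) :
    CompletesAfter α B ⟨t, 0, ∅, H, H, fut, .waitUntil τ⟩ X := by
  refine CompletesAfter.of_step (State.not_completed_of_pending hH) ?_
  rwa [State.step_eq_act fun r hr => by simpa [State.nextEvent] using hf r hr]

/-! ### Lower bounds on the length of schedules -/

theorem walkLength_sublist {l S : List Action} (h : l.Sublist S) (x : ℝ) :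
    walkLength x l + |endPos x S - endPos x l| ≤ walkLength x S := by
  induction h generalizing x with
  | slnil => simp [walkLength, endPos]
  | @cons l S A h ih =>
    have := ih A.loc
    cases l with
    | nil =>
      simp only [walkLength, endPos] at this ⊢
      have := abs_sub_le (endPos A.loc S) A.loc x
      linarith
    | cons A' l =>
      simp only [walkLength, endPos] at this ⊢
      have := abs_sub_le A'.loc A.loc x
      linarith
  | cons_cons A h ih =>
    have := ih A.loc
    simp only [walkLength, endPos] at this ⊢
    linarith

theorem walkLength_le_of_sublist {l S : List Action} (h : l.Sublist S) (x : ℝ) :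
    walkLength x l ≤ walkLength x S :=
  (le_add_of_nonneg_right (abs_nonneg _)).trans (walkLength_sublist h x)

theorem Serves.unload_mem {L U : Finset Request} {S : List Action} {r : Request}
    (h : Serves c L U S) (hr : r ∈ L) : Action.unload r ∈ S := by
  induction S generalizing L U with
  | nil => simp [h.1] at hr
  | cons A S ih =>
    cases A with
    | load r' => exact List.mem_cons_of_mem _ (ih h.2.2 (by simp [hr]))
    | unload r' =>
      by_cases hr' : r = r'
      · simp [hr']
      · exact List.mem_cons_of_mem _ (ih h.2 (by simp [hr, hr']))

theorem Serves.exists_append {L U : Finset Request} {S : List Action} {r : Request}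
    (h : Serves c L U S) (hr : r ∈ U) :
    ∃ P Q, S = P ++ Action.load r :: Q ∧ Action.unload r ∈ Q := by
  induction S generalizing L U with
  | nil => simp [h.2] at hr
  | cons A S ih =>
    have lift : (∃ P Q, S = P ++ Action.load r :: Q ∧ Action.unload r ∈ Q) →
        ∃ P Q, A :: S = P ++ Action.load r :: Q ∧ Action.unload r ∈ Q := by
      rintro ⟨P, Q, rfl, hQ⟩
      exact ⟨A :: P, Q, rfl, hQ⟩
    cases A with
    | load r' =>
      by_cases hr' : r = r'
      · subst hr'
        exact ⟨[], S, rfl, h.2.2.unload_mem (by simp)⟩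
      · exact lift (ih h.2.2 (by simp [hr, hr']))
    | unload r' => exact lift (ih h.2 hr)

theorem Serves.load_unload_sublist {L U : Finset Request} {S : List Action} {r : Request}
    (h : Serves c L U S) (hr : r ∈ U) : [Action.load r, Action.unload r].Sublist S := by
  obtain ⟨P, Q, rfl, hQ⟩ := h.exists_append hr
  exact ((List.singleton_sublist.2 hQ).cons_cons _).trans (List.sublist_append_right _ _)

theorem Serves.exists_load_cons {U : Finset Request} {S : List Action} (h : Serves c ∅ U S)
    (hU : U.Nonempty) : ∃ r ∈ U, ∃ S', S = .load r :: S' := by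
  rcases S with _ | ⟨r | r, S⟩
  · exact absurd h.2 hU.ne_empty
  · exact ⟨r, h.1, S, rfl⟩
  · exact absurd h.1 (by simp)

/-- A server of capacity one serves the requests one after the other. -/
theorem Serves.exists_load_unload_cons {U : Finset Request} {S : List Action}
    (h : Serves 1 ∅ U S) (hU : U.Nonempty) :
    ∃ r ∈ U, ∃ S', S = .load r :: .unload r :: S' ∧ Serves 1 ∅ (U.erase r) S' := by
  obtain ⟨r, hr, S, rfl⟩ := h.exists_load_cons hU
  obtain ⟨-, -, h⟩ := h
  rcases S with _ | ⟨r' | r', S⟩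
  · simp [Serves] at h
  · have := h.2.1
    simp only [insert_empty_eq, Finset.card_singleton, Nat.cast_one] at this
    exact absurd this (by decide)
  · have h1 := h.1
    have h2 := h.2
    simp only [insert_empty_eq, Finset.mem_singleton] at h1
    subst h1
    refine ⟨r', hr, S, rfl, ?_⟩
    simpa using h2

/-! ### Bounds on the offline optimum -/

theorem exists_timely (S : List Action) (x t : ℝ) :
    ∃ S' : List (ℝ × Action), S'.map Prod.snd = S ∧ Timely x t S' := by
  induction S generalizing x t with
  | nil => exact ⟨[], rfl, trivial⟩
  | cons A S ih =>
    obtain ⟨τ, h1, h2⟩ : ∃ τ, t + |A.loc - x| ≤ τ ∧ ∀ r, A = .load r → r.t ≤ τ := by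
      cases A with
      | load r => exact ⟨max _ r.t, le_max_left _ _, fun r' h => by
          cases h; exact le_max_right _ _⟩
      | unload r => exact ⟨_, le_rfl, fun r' h => by cases h⟩
    obtain ⟨S', h3, h4⟩ := ih A.loc τ
    exact ⟨(τ, A) :: S', by simp [h3], h1, h2, h4⟩

theorem Timely.walkLength_le {S : List (ℝ × Action)} {x t : ℝ} (h : Timely x t S) :
    t + walkLength x (S.map Prod.snd) ≤ completion t S := by
  induction S generalizing x t with
  | nil => simp [walkLength, completion]
  | cons A S ih =>
    obtain ⟨τ, A⟩ := A
    have := ih h.2.2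
    have := h.1
    simp only [List.map_cons, walkLength, completion]
    linarith

theorem le_opt (hc : 1 ≤ c) {R : Finset Request} {m : ℝ}
    (h : ∀ S, Serves c ∅ R S → m ≤ walkLength 0 S) : m ≤ opt c R := by
  refine le_csInf ?_ ?_
  · obtain ⟨S, hS⟩ := exists_serves hc R
    obtain ⟨S', h1, h2⟩ := exists_timely S 0 0
    exact ⟨_, S', h1 ▸ hS, h2, rfl⟩
  · rintro _ ⟨S, h1, h2, rfl⟩
    have := h2.walkLength_le
    have := h _ h1
    linarith

theorem opt_le {R : Finset Request} (S : List (ℝ × Action))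
    (h1 : Serves c ∅ R (S.map Prod.snd)) (h2 : Timely 0 0 S) : opt c R ≤ completion 0 S := by
  refine csInf_le ⟨0, ?_⟩ ⟨S, h1, h2, rfl⟩
  rintro _ ⟨S, h1, h2, rfl⟩
  have := h2.walkLength_le
  have := walkLength_nonneg 0 (S.map Prod.snd)
  linarith

theorem abs_le_opt (hc : 1 ≤ c) {R : Finset Request} {r : Request} (hr : r ∈ R) :
    |r.b| ≤ opt c R := by
  refine le_opt hc fun S hS => ?_
  have := walkLength_le_of_sublist (hS.load_unload_sublist hr) 0
  simp only [walkLength, Action.loc, sub_zero, add_zero] at this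
  have := abs_sub_abs_le_abs_sub r.b r.a
  linarith

/-! ### The competitive ratio -/

theorem le_competitiveRatio {ρ : ℝ}
    (h : ∀ η, 0 < η → η < 1 → ∃ σ, IsRequestSequence σ ∧ σ ≠ [] ∧ ∃ X T, 0 < T ∧
      opt c σ.toFinset ≤ T ∧ (ρ - η) * T ≤ X ∧ CompletesAfter α B (State.init σ) X) :
    ENNReal.ofReal ρ ≤ competitiveRatio α B := by
  have key : ∀ η, 0 < η → η < 1 → ENNReal.ofReal (ρ - η) ≤ competitiveRatio α B := by
    intro η h0 h1
    obtain ⟨σ, h2, h3, X, T, hT, h4, h5, h6⟩ := h η h0 h1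
    refine le_trans ?_ (le_iSup_of_le σ (le_iSup_of_le h2 (le_iSup_of_le h3 le_rfl)))
    calc ENNReal.ofReal (ρ - η) ≤ ENNReal.ofReal (X / T) :=
          ENNReal.ofReal_le_ofReal ((le_div_iff₀ hT).2 h5)
      _ = ENNReal.ofReal X / ENNReal.ofReal T := ENNReal.ofReal_div_of_pos hT
      _ ≤ _ := ENNReal.div_le_div h6.le_lazyTime (ENNReal.ofReal_le_ofReal h4)
  refine ENNReal.le_of_forall_pos_le_add fun η hη _ => ?_
  have h0 : (0 : ℝ) < min η (1 / 2) := by positivity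
  calc ENNReal.ofReal ρ = ENNReal.ofReal ((ρ - min η (1 / 2)) + min η (1 / 2)) := by congr 1; ring
    _ ≤ ENNReal.ofReal (ρ - min η (1 / 2)) + ENNReal.ofReal (min η (1 / 2)) :=
        ENNReal.ofReal_add_le
    _ ≤ _ := by
        refine add_le_add (key _ h0 ((min_le_right _ _).trans_lt (by norm_num))) ?_
        rw [← ENNReal.ofReal_coe_nnreal]
        exact ENNReal.ofReal_le_ofReal (min_le_left _ _)

/-! ### Explicit schedules -/

theorem CompletesAfter.mono {s : State} {X Y : ℝ} (h : CompletesAfter α B s X) (hY : Y ≤ X) :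
    CompletesAfter α B s Y := fun n hn => hY.trans (h n hn)

theorem Request.ne_of_lt {r r' : Request} (h : r.t < r'.t) : r ≠ r' := by
  rintro rfl
  exact lt_irrefl _ h

theorem serves_insert (hc : 1 ≤ c) {r : Request} {U : Finset Request} {S : List Action}
    (hr : r ∉ U) (h : Serves c ∅ U S) :
    Serves c ∅ (insert r U) (.load r :: .unload r :: S) := by
  refine ⟨by simp, by simpa using hc, by simp, ?_⟩
  simpa [Finset.erase_insert hr] using h

theorem serves_singleton (hc : 1 ≤ c) (r : Request) : Serves c ∅ {r} [.load r, .unload r] :=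
  serves_insert (U := ∅) hc (by simp) ⟨rfl, rfl⟩

theorem serves_pair (hc : 2 ≤ c) {r r' : Request} (h : r ≠ r') :
    Serves c ∅ {r, r'} [.load r, .load r', .unload r, .unload r'] := by
  have : ({r, r'} : Finset Request).erase r = {r'} := by
    rw [Finset.erase_insert (by simpa using h)]
  refine ⟨by simp, ?_, ?_, ?_, by simp, ?_, ?_, ?_⟩
  · simpa using (by norm_num : (1 : ℕ∞) ≤ 2).trans hc
  · rw [this]; simp
  · simpa [one_add_one_eq_two] using hc
  · simp [h.symm]
  · ext x
    simp only [Finset.mem_erase, Finset.mem_insert, Finset.notMem_empty]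
    tauto
  · rw [this]; simp

theorem timely_load {x t τ : ℝ} {r : Request} {S : List (ℝ × Action)} (h1 : t + (r.a - x) ≤ τ)
    (h2 : t + (x - r.a) ≤ τ) (h3 : r.t ≤ τ) (h : Timely r.a τ S) :
    Timely x t ((τ, .load r) :: S) := by
  refine ⟨?_, fun r' hr' => by cases hr'; exact h3, h⟩
  have : |r.a - x| ≤ τ - t := abs_le.2 ⟨by linarith, by linarith⟩
  simp only [Action.loc]
  linarith

theorem timely_unload {x t τ : ℝ} {r : Request} {S : List (ℝ × Action)} (h1 : t + (r.b - x) ≤ τ)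
    (h2 : t + (x - r.b) ≤ τ) (h : Timely r.b τ S) :
    Timely x t ((τ, .unload r) :: S) := by
  refine ⟨?_, fun r' hr' => Action.noConfusion hr', h⟩
  have : |r.b - x| ≤ τ - t := abs_le.2 ⟨by linarith, by linarith⟩
  simp only [Action.loc]
  linarith

theorem single_le_walkLength {r : Request} {R : Finset Request} {S : List Action} {x : ℝ}
    (h : Serves c ∅ R S) (hr : r ∈ R) : |r.a - x| + |r.b - r.a| ≤ walkLength x S := by
  simpa [walkLength, Action.loc] using walkLength_le_of_sublist (h.load_unload_sublist hr) x

/-! ### Large parameters -/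

theorem le_competitiveRatio_of_goldenRatio_le (hc : 1 ≤ c) (hα : Real.goldenRatio ≤ α) :
    ENNReal.ofReal (1 + Real.goldenRatio) ≤ competitiveRatio α B := by
  refine le_competitiveRatio fun η hη _ => ?_
  have h1 := Real.one_lt_goldenRatio
  let r : Request := ⟨1, 1, 1⟩
  have hO : 1 ≤ opt c {r} := by
    simpa [r] using abs_le_opt hc (Finset.mem_singleton_self r)
  refine ⟨[r], ⟨by simp [r], by simp⟩, by simp, α * opt c {r} + 1, 1, one_pos, ?_, ?_, ?_⟩
  · have : opt c {r} ≤ 1 := opt_le [(1, .load r), (1, .unload r)] (serves_singleton hc r)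
      (timely_load (by simp [r]) (by simp [r]) le_rfl
        (timely_unload (by simp [r]) (by simp [r]) trivial))
    simpa using this
  · nlinarith
  · refine completesAfter_init one_pos ?_ (by simp) (completesAfter_wait (by simp) (by simp)
      (completesAfter_idle_last subset_rfl (by simp) fun S hS => ?_))
    · show 1 < _
      nlinarith
    · simpa [r] using single_le_walkLength (x := 0) hS (Finset.mem_singleton_self r)

theorem goldenRatio_bounds : 1.6 < Real.goldenRatio ∧ Real.goldenRatio < 1.62 := by
  have h1 := Real.goldenRatio_sq
  have h2 := Real.one_lt_goldenRatio
  constructor <;> nlinarith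

/-! ### The parameter zero -/

theorem le_competitiveRatio_zero (hc : 1 ≤ c) (B : TieBreaking c) :
    ENNReal.ofReal (1 + Real.goldenRatio) ≤ competitiveRatio 0 B := by
  refine le_competitiveRatio fun η hη _ => ?_
  have hφ := goldenRatio_bounds.2
  obtain ⟨r, hr⟩ : ∃ r : Request, r = ⟨1, 1, 1 / 100⟩ := ⟨_, rfl⟩
  obtain ⟨q, hq⟩ : ∃ q : Request, q = ⟨0, 1, 1 / 50⟩ := ⟨_, rfl⟩
  have hrt : r.t = 1 / 100 := by rw [hr]
  have hqt : q.t = 1 / 50 := by rw [hq]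
  have hne : q ≠ r := (Request.ne_of_lt (by rw [hrt, hqt]; norm_num)).symm
  have hS := B.sched_spec {r} r.t {r} 0
  have hw := hS.2 _ (serves_singleton hc r)
  have hw' := single_le_walkLength (x := 0) hS.1 (Finset.mem_singleton_self r)
  have he := walkLength_sublist (hS.1.load_unload_sublist (Finset.mem_singleton_self r)) 0
  simp only [walkLength, endPos, Action.loc, hr, sub_zero, sub_self, abs_one, abs_zero,
    add_zero] at hw hw' he
  rw [← hr] at hw hw' he
  have he' : endPos 0 (B.sched {r} (1 / 100) {r} 0) = 1 := by
    rw [← sub_eq_zero, ← abs_nonpos_iff]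
    linarith
  refine ⟨[r, q], ⟨by simp [hrt, hqt], by simp [hrt, hqt]; norm_num⟩, by simp, 1 / 100 + 1 + 2,
    1 + 1 / 50, by norm_num, ?_, by nlinarith, ?_⟩
  · have hs : ([r, q].toFinset) = insert q {r} := by ext; simp [or_comm]
    rw [hs]
    refine opt_le [(1 / 50, .load q), (1 + 1 / 50, .unload q), (1 + 1 / 50, .load r),
      (1 + 1 / 50, .unload r)] (serves_insert hc (by simpa using hne) (serves_singleton hc r)) ?_
    refine timely_load ?_ ?_ ?_ (timely_unload ?_ ?_ (timely_load ?_ ?_ ?_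
      (timely_unload ?_ ?_ trivial))) <;> simp only [hr, hq] <;> norm_num
  · refine CompletesAfter.of_step (State.not_completed_of_future rfl) ?_
    rw [State.step_eq_release (r := r) (fut := [q]) rfl (by simp [nextEvent_init])]
    have hrel : (State.init [r, q]).release r [q] =
        ⟨1 / 100, 0, ∅, {r}, {r}, [q], .idle⟩ := by
      simp [State.release, State.init, Command.heading, hrt, moveToward]
    rw [hrel, Far.react (K := 1 / 100) (Or.inl (by simp)) (by norm_num)]
    refine completesAfter_idle (by norm_num) (by simp)
      (by simp only [List.head?_cons, Option.mem_def, Option.some.injEq]; rintro _ rfl; linarith) ?_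
    refine (following_sched subset_rfl).completesAfter_release (r := q) (K := 1 / 100) rfl
      (by rw [hqt]; norm_num) (by linarith) (Or.inl (by simp)) (by norm_num)
      (by simpa using hne) ?_
    intro s S U hs hf ht hrel' _
    refine hs.completesAfter (by simp) (by simp [hf]) ?_
    rw [he', hf, hrel']
    refine (completesAfter_idle_last (d := 2) (by simp) (by simp) fun S hS => ?_).mono ?_
    · have := single_le_walkLength (x := 1) hS (Finset.mem_insert_self q ∅)
      simp only [hq] at this
      norm_num at this
      linarith
    · linarith

/-! ### Small positive parameters -/

/-- From `0`, a shortest schedule for `(0, 1/2)` and `(1, 1)` loads the first request immediately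
and ends in `1`. -/
theorem IsShortestSchedule.end_one {r q : Request} {S : List Action} (hc : 1 ≤ c)
    (hra : r.a = 0) (hrb : r.b = 1 / 2) (hqa : q.a = 1) (hqb : q.b = 1)
    (hS : IsShortestSchedule c {q, r} 0 S) :
    endPos 0 S = 1 ∧ walkLength 0 S = 1 ∧ ∃ S', S = .load r :: S' := by
  have hqr : q ≠ r := by rintro rfl; linarith
  have hw := hS.2 [.load r, .unload r, .load q, .unload q] (by
    rw [Finset.pair_comm]
    exact serves_insert hc (by simpa using hqr.symm) (serves_singleton hc q))
  have hs := walkLength_sublist (hS.1.load_unload_sublist (r := q) (by simp)) 0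
  simp only [walkLength, endPos, Action.loc, hra, hrb, hqa, hqb] at hw hs
  norm_num at hw hs
  have := abs_nonneg (endPos 0 S - 1)
  refine ⟨?_, by linarith, ?_⟩
  · rw [← sub_eq_zero, ← abs_nonpos_iff]
    linarith
  obtain ⟨r', hr', S', rfl⟩ := hS.1.exists_load_cons (by simp)
  simp only [Finset.mem_insert, Finset.mem_singleton] at hr'
  rcases hr' with rfl | rfl
  · exfalso
    obtain ⟨P, Q, h1, -⟩ := hS.1.exists_append (r := r) (by simp)
    have hm : Action.load r ∈ S' := by
      have : Action.load r ∈ Action.load r' :: S' := by rw [h1]; simp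
      simpa [hqr.symm] using this
    have := walkLength_le_of_sublist ((List.singleton_sublist.2 hm).cons_cons (.load r')) 0
    simp only [walkLength, Action.loc, hra, hqa] at this hw
    norm_num at this hw
    linarith
  · exact ⟨S', rfl⟩

/-- From `1`, a shortest schedule for `(0, 0)` and `(1/2 + ε, 1)` ends in `0`. -/
theorem IsShortestSchedule.end_zero {r q : Request} {S : List Action} {ε : ℝ} (hc : 1 ≤ c)
    (h0 : 0 < ε) (hε : ε < 1 / 2)
    (hra : r.a = 0) (hrb : r.b = 0) (hqa : q.a = 1 / 2 + ε) (hqb : q.b = 1)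
    (hS : IsShortestSchedule c {q, r} 1 S) :
    endPos 1 S = 0 ∧ walkLength 1 S = 2 - 2 * ε := by
  have hqr : q ≠ r := by rintro rfl; linarith
  have e1 : |1 / 2 + ε - 1| = 1 / 2 - ε := by rw [abs_of_nonpos (by linarith)]; ring
  have e2 : |1 - (1 / 2 + ε)| = 1 / 2 - ε := by rw [abs_of_nonneg (by linarith)]; ring
  have e3 : |1 / 2 + ε - 0| = 1 / 2 + ε := by rw [abs_of_nonneg (by linarith)]; ring
  have e4 : |0 - (1 / 2 + ε)| = 1 / 2 + ε := by rw [abs_of_nonpos (by linarith)]; ring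
  have hw := hS.2 [.load q, .unload q, .load r, .unload r]
    (serves_insert hc (by simpa using hqr) (serves_singleton hc r))
  simp only [walkLength, Action.loc, hra, hrb, hqa, hqb, e1, e2] at hw
  norm_num at hw
  obtain ⟨P, Q, rfl, hQ⟩ := hS.1.exists_append (r := q) (by simp)
  have hr : Action.load r ∈ P ++ Action.load q :: Q := by
    obtain ⟨P', Q', h, -⟩ := hS.1.exists_append (r := r) (by simp)
    rw [h]; simp
  have main : [Action.load q, .unload q, .load r].Sublist (P ++ Action.load q :: Q) := by
    simp only [List.mem_append, List.mem_cons, Action.load.injEq, hqr.symm, false_or] at hr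
    rcases hr with hr | hr
    · exfalso
      have := walkLength_le_of_sublist ((List.singleton_sublist.2 hr).append
        ((List.singleton_sublist.2 hQ).cons_cons (.load q))) 1
      simp only [List.cons_append, List.nil_append, walkLength, Action.loc, hra, hqa, hqb,
        e2, e3] at this
      norm_num at this
      linarith
    · obtain ⟨Q₁, Q₂, rfl⟩ := List.append_of_mem hQ
      simp only [List.mem_append, List.mem_cons, reduceCtorEq, false_or] at hr
      rcases hr with hr | hr
      · exfalso
        have := walkLength_le_of_sublist ((((List.singleton_sublist.2 hr).append
          ((List.nil_sublist Q₂).cons_cons (.unload q))).cons_cons (.load q)).trans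
            (List.sublist_append_right P _)) 1
        simp only [List.cons_append, List.nil_append, walkLength, Action.loc, hra, hqa, hqb,
          e1, e4] at this
        norm_num at this
        linarith
      · exact ((((List.singleton_sublist.2 hr).cons_cons (.unload q)).trans
          (List.sublist_append_right Q₁ _)).cons_cons _).trans (List.sublist_append_right P _)
  have hs := walkLength_sublist main 1
  simp only [walkLength, endPos, Action.loc, hra, hqa, hqb, e1, e2] at hs
  norm_num at hs
  have := abs_nonneg (endPos 1 (P ++ Action.load q :: Q))
  refine ⟨?_, by linarith⟩
  rw [← abs_nonpos_iff]
  linarith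

theorem opt_le_of_three {r₁ r₂ r₃ : Request} {ε b : ℝ}
    (hr₁ : r₁ = ⟨0, 1 / 2, ε⟩) (hr₂ : r₂ = ⟨1, 1, 2 * ε⟩) (hr₃ : r₃ = ⟨0, 0, b + ε⟩)
    (hc : 1 ≤ c) (h0 : 0 < ε) (hε : ε ≤ 1 / 100) (hb : 4 * ε < b) :
    opt c (insert r₃ {r₂, r₁}) ≤ b + 1 + ε := by
  have t₁ : r₁.t = ε := by rw [hr₁]
  have t₂ : r₂.t = 2 * ε := by rw [hr₂]
  have t₃ : r₃.t = b + ε := by rw [hr₃]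
  have n₁₂ : r₁ ≠ r₂ := Request.ne_of_lt (by linarith)
  have n₁₃ : r₁ ≠ r₃ := Request.ne_of_lt (by linarith)
  have n₂₃ : r₂ ≠ r₃ := Request.ne_of_lt (by linarith)
  rw [Finset.pair_comm]
  refine opt_le [(b + ε, .load r₃), (b + ε, .unload r₃), (b + ε, .load r₁),
    (b + 1 / 2 + ε, .unload r₁), (b + 1 + ε, .load r₂), (b + 1 + ε, .unload r₂)]
    (serves_insert hc (by simp [n₁₃.symm, n₂₃.symm])
      (serves_insert hc (by simpa using n₁₂) (serves_singleton hc r₂))) ?_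
  refine timely_load ?_ ?_ ?_ (timely_unload ?_ ?_ (timely_load ?_ ?_ ?_
    (timely_unload ?_ ?_ (timely_load ?_ ?_ ?_ (timely_unload ?_ ?_ trivial))))) <;>
  simp only [hr₁, hr₂, hr₃] <;> linarith

theorem opt_le_of_four {r₁ r₂ r₃ r₄ : Request} {ε b : ℝ}
    (hr₁ : r₁ = ⟨0, 1 / 2, ε⟩) (hr₂ : r₂ = ⟨1, 1, 2 * ε⟩) (hr₃ : r₃ = ⟨0, 0, b + ε⟩)
    (hr₄ : r₄ = ⟨1 / 2 + ε, 1, b + 2 * ε⟩)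
    (hc : 1 ≤ c) (h0 : 0 < ε) (hε : ε ≤ 1 / 100) (hb : 4 * ε < b) :
    opt c (insert r₄ (insert r₃ {r₂, r₁})) ≤ b + 1 + 2 * ε := by
  have t₁ : r₁.t = ε := by rw [hr₁]
  have t₂ : r₂.t = 2 * ε := by rw [hr₂]
  have t₃ : r₃.t = b + ε := by rw [hr₃]
  have t₄ : r₄.t = b + 2 * ε := by rw [hr₄]
  have n₁₂ : r₁ ≠ r₂ := Request.ne_of_lt (by linarith)
  have n₁₃ : r₁ ≠ r₃ := Request.ne_of_lt (by linarith)
  have n₁₄ : r₁ ≠ r₄ := Request.ne_of_lt (by linarith)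
  have n₂₃ : r₂ ≠ r₃ := Request.ne_of_lt (by linarith)
  have n₂₄ : r₂ ≠ r₄ := Request.ne_of_lt (by linarith)
  have n₃₄ : r₃ ≠ r₄ := Request.ne_of_lt (by linarith)
  have : (insert r₄ (insert r₃ {r₂, r₁}) : Finset Request) = {r₃, r₁, r₄, r₂} := by
    ext; simp only [Finset.mem_insert, Finset.mem_singleton]; tauto
  rw [this]
  refine opt_le [(b + 2 * ε, .load r₃), (b + 2 * ε, .unload r₃),
    (b + 2 * ε, .load r₁), (b + 1 / 2 + 2 * ε, .unload r₁),
    (b + 1 / 2 + 3 * ε, .load r₄), (b + 1 + 2 * ε, .unload r₄),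
    (b + 1 + 2 * ε, .load r₂), (b + 1 + 2 * ε, .unload r₂)]
    (serves_insert hc (by simp [n₁₃.symm, n₂₃.symm, n₃₄])
      (serves_insert hc (by simp [n₁₂, n₁₄])
        (serves_insert hc (by simpa using n₂₄.symm) (serves_singleton hc r₂)))) ?_
  refine timely_load ?_ ?_ ?_ (timely_unload ?_ ?_ (timely_load ?_ ?_ ?_
    (timely_unload ?_ ?_ (timely_load ?_ ?_ ?_ (timely_unload ?_ ?_ (timely_load ?_ ?_ ?_
      (timely_unload ?_ ?_ trivial))))))) <;>
  simp only [hr₁, hr₂, hr₃, hr₄] <;> linarith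

theorem opt_le_of_five {r₁ r₂ r₃ r₄ r₅ : Request} {ε b : ℝ}
    (hr₁ : r₁ = ⟨0, 1 / 2, ε⟩) (hr₂ : r₂ = ⟨1, 1, 2 * ε⟩) (hr₃ : r₃ = ⟨0, 0, b + ε⟩)
    (hr₄ : r₄ = ⟨1 / 2 + ε, 1, b + 2 * ε⟩) (hr₅ : r₅ = ⟨1, 1, b + 1 + 3 * ε⟩)
    (hc : 1 ≤ c) (h0 : 0 < ε) (hε : ε ≤ 1 / 100) (hb : 4 * ε < b) :
    opt c (insert r₅ (insert r₄ (insert r₃ {r₂, r₁}))) ≤ b + 1 + 3 * ε := by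
  have t₁ : r₁.t = ε := by rw [hr₁]
  have t₂ : r₂.t = 2 * ε := by rw [hr₂]
  have t₃ : r₃.t = b + ε := by rw [hr₃]
  have t₄ : r₄.t = b + 2 * ε := by rw [hr₄]
  have t₅ : r₅.t = b + 1 + 3 * ε := by rw [hr₅]
  have n₁₂ : r₁ ≠ r₂ := Request.ne_of_lt (by linarith)
  have n₁₃ : r₁ ≠ r₃ := Request.ne_of_lt (by linarith)
  have n₁₄ : r₁ ≠ r₄ := Request.ne_of_lt (by linarith)
  have n₁₅ : r₁ ≠ r₅ := Request.ne_of_lt (by linarith)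
  have n₂₃ : r₂ ≠ r₃ := Request.ne_of_lt (by linarith)
  have n₂₄ : r₂ ≠ r₄ := Request.ne_of_lt (by linarith)
  have n₂₅ : r₂ ≠ r₅ := Request.ne_of_lt (by linarith)
  have n₃₄ : r₃ ≠ r₄ := Request.ne_of_lt (by linarith)
  have n₃₅ : r₃ ≠ r₅ := Request.ne_of_lt (by linarith)
  have n₄₅ : r₄ ≠ r₅ := Request.ne_of_lt (by linarith)
  have : (insert r₅ (insert r₄ (insert r₃ {r₂, r₁})) : Finset Request) =
      {r₃, r₁, r₄, r₂, r₅} := by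
    ext; simp only [Finset.mem_insert, Finset.mem_singleton]; tauto
  rw [this]
  refine opt_le [(b + 2 * ε, .load r₃), (b + 2 * ε, .unload r₃),
    (b + 2 * ε, .load r₁), (b + 1 / 2 + 2 * ε, .unload r₁),
    (b + 1 / 2 + 3 * ε, .load r₄), (b + 1 + 2 * ε, .unload r₄),
    (b + 1 + 2 * ε, .load r₂), (b + 1 + 2 * ε, .unload r₂),
    (b + 1 + 3 * ε, .load r₅), (b + 1 + 3 * ε, .unload r₅)]
    (serves_insert hc (by simp [n₁₃.symm, n₂₃.symm, n₃₄, n₃₅])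
      (serves_insert hc (by simp [n₁₂, n₁₄, n₁₅])
        (serves_insert hc (by simp [n₂₄.symm, n₄₅])
          (serves_insert hc (by simpa using n₂₅) (serves_singleton hc r₅))))) ?_
  refine timely_load ?_ ?_ ?_ (timely_unload ?_ ?_ (timely_load ?_ ?_ ?_
    (timely_unload ?_ ?_ (timely_load ?_ ?_ ?_ (timely_unload ?_ ?_ (timely_load ?_ ?_ ?_
      (timely_unload ?_ ?_ (timely_load ?_ ?_ ?_ (timely_unload ?_ ?_ trivial))))))))) <;>
  simp only [hr₁, hr₂, hr₃, hr₄, hr₅] <;> linarith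

theorem completesAfter_of_small {r₁ r₂ r₃ r₄ r₅ : Request} {ε O : ℝ}
    (hr₁ : r₁ = ⟨0, 1 / 2, ε⟩) (hr₂ : r₂ = ⟨1, 1, 2 * ε⟩) (hr₃ : r₃ = ⟨0, 0, α * O + ε⟩)
    (hr₄ : r₄ = ⟨1 / 2 + ε, 1, α * O + 2 * ε⟩) (hr₅ : r₅ = ⟨1, 1, α * O + 1 + 3 * ε⟩)
    (hα : 0 < α) (h0 : 0 < ε) (hεα : 4 * ε < α) (hε : ε ≤ 1 / 100) (hc : 1 ≤ c)
    (hO : O = opt c {r₂, r₁}) (hO₁ : 1 / 2 ≤ opt c {r₁}) (hO1 : 1 ≤ O)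
    (hαT : α * (α * O + 1 + 3 * ε) < α * O + 1) :
    CompletesAfter α B (State.init [r₁, r₂, r₃, r₄, r₅]) (α * O + 4 - 2 * ε) := by
  have hαO : α ≤ α * O := by nlinarith
  have hO₃ := opt_le_of_three hr₁ hr₂ hr₃ hc h0 hε (by linarith)
  have hO₄ := opt_le_of_four hr₁ hr₂ hr₃ hr₄ hc h0 hε (by linarith)
  have hO₅ := opt_le_of_five hr₁ hr₂ hr₃ hr₄ hr₅ hc h0 hε (by linarith)
  have t₁ : r₁.t = ε := by rw [hr₁]
  have t₂ : r₂.t = 2 * ε := by rw [hr₂]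
  have t₃ : r₃.t = α * O + ε := by rw [hr₃]
  have t₄ : r₄.t = α * O + 2 * ε := by rw [hr₄]
  have t₅ : r₅.t = α * O + 1 + 3 * ε := by rw [hr₅]
  have n₁₂ : r₁ ≠ r₂ := Request.ne_of_lt (by linarith)
  have n₁₃ : r₁ ≠ r₃ := Request.ne_of_lt (by linarith)
  have n₁₄ : r₁ ≠ r₄ := Request.ne_of_lt (by linarith)
  have n₁₅ : r₁ ≠ r₅ := Request.ne_of_lt (by linarith)
  have n₂₃ : r₂ ≠ r₃ := Request.ne_of_lt (by linarith)
  have n₂₄ : r₂ ≠ r₄ := Request.ne_of_lt (by linarith)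
  have n₂₅ : r₂ ≠ r₅ := Request.ne_of_lt (by linarith)
  have n₃₄ : r₃ ≠ r₄ := Request.ne_of_lt (by linarith)
  have n₃₅ : r₃ ≠ r₅ := Request.ne_of_lt (by linarith)
  have n₄₅ : r₄ ≠ r₅ := Request.ne_of_lt (by linarith)
  have mono : ∀ {x : ℝ}, x ≤ α * O + 1 + 3 * ε → α * x < α * O + 1 := fun hx =>
    (mul_le_mul_of_nonneg_left hx hα.le).trans_lt hαT
  obtain ⟨he, hw, S, hS⟩ := (B.sched_spec {r₂, r₁} (α * O) {r₂, r₁} 0).end_one hc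
    (by rw [hr₁]) (by rw [hr₁]) (by rw [hr₂]) (by rw [hr₂])
  refine completesAfter_init (by linarith) (by nlinarith) (by simp [t₁, t₂, h0]) ?_
  refine completesAfter_wait_release (by linarith) (by nlinarith) (by rw [← hO]; linarith)
    (by simp [t₂, t₃]; linarith) ?_
  rw [← hO]
  refine completesAfter_wait (by simp) (by simp [t₃, h0]) ?_
  refine completesAfter_idle_load subset_rfl (by rw [hO]) (by simp) (by simp [t₃, h0]) (by simp)
    hS (by rw [hr₁]) ?_
  rw [he, hw]
  intro s U hs hf ht hH hfar
  have hK : α * O + |r₁.b - r₁.a| + |r₁.b| = α * O + 1 := by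
    rw [hr₁]; norm_num [abs_of_pos]; ring
  rw [hK] at hfar
  refine hs.completesAfter_release hf (by linarith) (by linarith) hfar
    (by rw [hH]; exact mono (by linarith)) (by rw [hH]; simp [n₁₃.symm, n₂₃.symm]) ?_
  intro s S U hs hf ht hH' hfar
  rw [hH] at hH'
  refine hs.completesAfter_release hf (by linarith) (by linarith) hfar
    (by rw [hH']; exact mono (by linarith))
    (by rw [hH']; simp [n₁₄.symm, n₂₄.symm, n₃₄.symm]) ?_
  intro s S U hs hf ht hH hfar
  rw [hH'] at hH
  refine hs.completesAfter (by simp) (by simp [hf, t₅, h0]) ?_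
  rw [hH, hf]
  have hop : α * opt c (insert r₄ (insert r₃ {r₂, r₁})) ≤ α * O + 1 := (mono (by linarith)).le
  have hS := B.sched_spec (insert r₄ (insert r₃ {r₂, r₁})) (α * O + 1)
    (insert r₄ (insert r₃ ∅)) 1
  obtain ⟨he, hw⟩ := hS.end_zero (ε := ε) hc h0 (by linarith)
    (by rw [hr₃]) (by rw [hr₃]) (by rw [hr₄]) (by rw [hr₄])
  refine completesAfter_idle hop (by simp) (by simp [t₅, h0]) ?_
  refine (following_sched ?_).completesAfter_release (r := r₅) (K := α * O + 1 + 1)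
    rfl (by simp only; linarith) (by linarith) (Or.inl (by simp)) ?_ ?_ ?_
  · intro r; simp only [Finset.mem_insert]; tauto
  · have := mono (x := opt c (insert r₅ (insert r₄ (insert r₃ {r₂, r₁})))) hO₅
    simp only
    linarith
  · simp [n₁₅.symm, n₂₅.symm, n₃₅.symm, n₄₅.symm]
  intro s S U hs hf ht hH hfar
  refine hs.completesAfter (by simp) (by simp [hf]) ?_
  rw [he, hw, hf, hH]
  refine (completesAfter_idle_last (d := 1) ?_ (by simp) fun S hS => ?_).mono ?_
  · intro r; simp only [Finset.mem_insert]; tauto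
  · have := single_le_walkLength (x := 0) hS (Finset.mem_insert_self r₅ ∅)
    simp only [hr₅] at this
    norm_num at this
    linarith
  · linarith

theorem le_competitiveRatio_of_le (hc : 1 ≤ c) (hα : 0 < α)
    (hα' : α ≤ 3 * Real.goldenRatio - 4) :
    ENNReal.ofReal (1 + Real.goldenRatio) ≤ competitiveRatio α B := by
  refine le_competitiveRatio fun η hη _ => ?_
  obtain ⟨φ1, φ2⟩ := goldenRatio_bounds
  have φ3 := Real.goldenRatio_sq
  obtain ⟨ε, h0, hεα, hεη, hε⟩ : ∃ ε : ℝ, 0 < ε ∧ 4 * ε < α ∧ 14 * ε ≤ η ∧ ε ≤ 1 / 100 :=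
    ⟨min (α / 5) (min (η / 14) (1 / 100)), by positivity,
      by linarith [min_le_left (α / 5) (min (η / 14) (1 / 100))],
      by linarith [(min_le_right (α / 5) _).trans (min_le_left (η / 14) (1 / 100))],
      (min_le_right _ _).trans (min_le_right _ _)⟩
  obtain ⟨r₁, hr₁⟩ : ∃ r : Request, r = ⟨0, 1 / 2, ε⟩ := ⟨_, rfl⟩
  obtain ⟨r₂, hr₂⟩ : ∃ r : Request, r = ⟨1, 1, 2 * ε⟩ := ⟨_, rfl⟩
  obtain ⟨O, hO⟩ : ∃ O, O = opt c {r₂, r₁} := ⟨_, rfl⟩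
  obtain ⟨r₃, hr₃⟩ : ∃ r : Request, r = ⟨0, 0, α * O + ε⟩ := ⟨_, rfl⟩
  obtain ⟨r₄, hr₄⟩ : ∃ r : Request, r = ⟨1 / 2 + ε, 1, α * O + 2 * ε⟩ := ⟨_, rfl⟩
  obtain ⟨r₅, hr₅⟩ : ∃ r : Request, r = ⟨1, 1, α * O + 1 + 3 * ε⟩ := ⟨_, rfl⟩
  have t₁ : r₁.t = ε := by rw [hr₁]
  have t₂ : r₂.t = 2 * ε := by rw [hr₂]
  have t₃ : r₃.t = α * O + ε := by rw [hr₃]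
  have t₄ : r₄.t = α * O + 2 * ε := by rw [hr₄]
  have t₅ : r₅.t = α * O + 1 + 3 * ε := by rw [hr₅]
  have hO₁ : 1 / 2 ≤ opt c {r₁} := by
    have := abs_le_opt hc (Finset.mem_singleton_self r₁)
    rw [hr₁] at this ⊢
    norm_num at this ⊢
    exact this
  have hO1 : 1 ≤ O := by
    have := abs_le_opt hc (Finset.mem_insert_self r₂ {r₁})
    rw [← hO, hr₂] at this
    simpa using this
  have hαO : α ≤ α * O := by nlinarith
  have n₁₂ : r₁ ≠ r₂ := Request.ne_of_lt (by linarith)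
  have hO2 : O ≤ 1 + 2 * ε := by
    rw [hO, Finset.pair_comm]
    refine opt_le [(2 * ε, .load r₁), (1 / 2 + 2 * ε, .unload r₁), (1 + 2 * ε, .load r₂),
      (1 + 2 * ε, .unload r₂)] (serves_insert hc (by simpa using n₁₂) (serves_singleton hc r₂)) ?_
    refine timely_load ?_ ?_ ?_ (timely_unload ?_ ?_ (timely_load ?_ ?_ ?_
      (timely_unload ?_ ?_ trivial))) <;> simp only [hr₁, hr₂] <;> linarith
  have hαT : α * (α * O + 1 + 3 * ε) < α * O + 1 := by nlinarith
  have hO₅ := opt_le_of_five hr₁ hr₂ hr₃ hr₄ hr₅ hc h0 hε (by linarith)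
  refine ⟨[r₁, r₂, r₃, r₄, r₅], ⟨?_, ?_⟩, by simp, α * O + 4 - 2 * ε, α * O + 1 + 3 * ε,
    by linarith, ?_, ?_, ?_⟩
  · simp only [List.mem_cons, List.not_mem_nil, or_false, forall_eq_or_imp, forall_eq, t₁, t₂, t₃,
      t₄, t₅]
    refine ⟨?_, ?_, ?_, ?_, ?_⟩ <;> linarith
  · simp only [List.pairwise_cons, List.mem_cons, List.not_mem_nil, or_false, forall_eq_or_imp,
      forall_eq, t₁, t₂, t₃, t₄, t₅, List.Pairwise.nil, and_true, false_imp_iff, implies_true]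
    refine ⟨⟨?_, ?_, ?_, ?_⟩, ⟨?_, ?_, ?_⟩, ⟨?_, ?_⟩, ?_⟩ <;> linarith
  · have : [r₁, r₂, r₃, r₄, r₅].toFinset = insert r₅ (insert r₄ (insert r₃ {r₂, r₁})) := by
      ext; simp only [List.mem_toFinset, List.mem_cons, List.not_mem_nil, Finset.mem_insert,
        Finset.mem_singleton]; tauto
    rwa [this]
  · have h1 : Real.goldenRatio * (α * O + 1) ≤ 3 + 4 * ε := by nlinarith
    nlinarith
  · exact completesAfter_of_small hr₁ hr₂ hr₃ hr₄ hr₅ hα h0 hεα hε hc hO hO₁ hO1 hαT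

/-! ### Intermediate parameters -/

/-- A schedule for `(0, u)`, `(0, -v)` and `(p, q)` that starts by serving `(0, -v)`. -/
theorem serves_triple (hc : 1 ≤ c) {r₁ r₂ r₃ : Request} (h₁₂ : r₁ ≠ r₂) (h₁₃ : r₁ ≠ r₃)
    (h₂₃ : r₂ ≠ r₃) : Serves c ∅ {r₃, r₂, r₁}
      [.load r₂, .unload r₂, .load r₃, .unload r₃, .load r₁, .unload r₁] := by
  rw [Finset.insert_comm]
  exact serves_insert hc (by simp [h₂₃, h₁₂.symm])
    (serves_insert hc (by simpa using h₁₃.symm) (serves_singleton hc r₁))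

/-- A schedule from `0` that ends in `u`, has length at least `ℓ`, and starts by loading a request
in the origin whose destination has distance at least `m` from the origin. -/
structure StartsAndEnds (u ℓ m : ℝ) (S : List Action) : Prop where
  last : endPos 0 S = u
  length : ℓ ≤ walkLength 0 S
  first : ∃ r S', S = .load r :: S' ∧ r.a = 0 ∧ m ≤ |r.b|

theorem walkLength_triple_le {r₁ r₂ r₃ : Request} {u v p q : ℝ} {S : List Action} (hc : 1 ≤ c)
    (h₁₂ : r₁ ≠ r₂) (h₁₃ : r₁ ≠ r₃) (h₂₃ : r₂ ≠ r₃) (hu : 0 < u) (hp : -v ≤ p) (hpq : p ≤ q)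
    (hq : q ≤ 0) (a₁ : r₁.a = 0) (b₁ : r₁.b = u) (a₂ : r₂.a = 0) (b₂ : r₂.b = -v) (a₃ : r₃.a = p)
    (b₃ : r₃.b = q) (hS : IsShortestSchedule c {r₃, r₂, r₁} 0 S) :
    walkLength 0 S ≤ 2 * v + u := by
  have hw := hS.2 _ (serves_triple hc h₁₂ h₁₃ h₂₃)
  simp only [walkLength, Action.loc, a₁, b₁, a₂, b₂, a₃, b₃] at hw
  rw [abs_of_nonpos (by linarith : -v - 0 ≤ 0), abs_of_nonneg (by linarith : 0 ≤ p - -v),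
    abs_of_nonneg (by linarith : 0 ≤ q - p), abs_of_nonneg (by linarith : 0 ≤ 0 - q),
    abs_of_pos (by linarith : 0 < u - 0)] at hw
  norm_num at hw
  linarith

/-- Shortest schedules for `(0, u)`, `(0, -v)` and `(-v, q)`, where `q > -u`. -/
theorem IsShortestSchedule.startsAndEnds {r₁ r₂ r₃ : Request} {u v q : ℝ} {S : List Action}
    (hc : 1 ≤ c) (hu : 0 < u) (hv : 0 < v) (hvq : -v ≤ q) (hqu : -u < q) (hq : q ≤ 0)
    (h₁₂ : r₁ ≠ r₂) (h₁₃ : r₁ ≠ r₃) (h₂₃ : r₂ ≠ r₃) (huv : u ≤ v)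
    (a₁ : r₁.a = 0) (b₁ : r₁.b = u) (a₂ : r₂.a = 0) (b₂ : r₂.b = -v) (a₃ : r₃.a = -v)
    (b₃ : r₃.b = q) (hS : IsShortestSchedule c {r₃, r₂, r₁} 0 S) :
    StartsAndEnds u (2 * v + u) u S := by
  have hw := walkLength_triple_le hc h₁₂ h₁₃ h₂₃ hu le_rfl hvq hq a₁ b₁ a₂ b₂ a₃ b₃ hS
  have e1 : |-v - u| = v + u := by rw [abs_of_nonpos (by linarith)]; ring
  have e2 : |q - -v| = q + v := by rw [abs_of_nonneg (by linarith)]; ring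
  have e3 : |u - -v| = v + u := by rw [abs_of_nonneg (by linarith)]; ring
  have hsub : [Action.load r₃, .unload r₁].Sublist S := by
    obtain ⟨P, Q, rfl, hQ⟩ := hS.1.exists_append (r := r₃) (by simp)
    have h : Action.unload r₁ ∈ P ++ Action.load r₃ :: Q := by
      obtain ⟨P', Q', h, h'⟩ := hS.1.exists_append (r := r₁) (by simp)
      rw [h]; simp [h']
    simp only [List.mem_append, List.mem_cons, reduceCtorEq, false_or] at h
    rcases h with h | h
    · exfalso
      have := walkLength_le_of_sublist ((List.singleton_sublist.2 h).append
        ((List.singleton_sublist.2 hQ).cons_cons (.load r₃))) 0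
      simp only [List.cons_append, List.nil_append, walkLength, Action.loc, b₁, a₃, b₃, sub_zero,
        abs_of_pos hu, e1, e2] at this
      linarith
    · exact ((List.singleton_sublist.2 h).cons_cons _).trans (List.sublist_append_right _ _)
  have hs := walkLength_sublist hsub 0
  simp only [walkLength, endPos, Action.loc, b₁, a₃, sub_zero, abs_neg, abs_of_pos hv, e3] at hs
  have hlast : endPos 0 S = u := by
    rw [← sub_eq_zero, ← abs_nonpos_iff]
    linarith
  refine ⟨hlast, by linarith [abs_nonneg (endPos 0 S - u)], ?_⟩
  obtain ⟨r, hr, S', rfl⟩ := hS.1.exists_load_cons (by simp)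
  refine ⟨r, S', rfl, ?_⟩
  simp only [Finset.mem_insert, Finset.mem_singleton] at hr
  rcases hr with rfl | rfl | rfl
  · exfalso
    have hr₂ := hS.1.2.2.load_unload_sublist (r := r₂) (by simp [h₂₃])
    have := walkLength_sublist (hr₂.cons_cons (.load r)) 0
    rw [hlast] at this
    simp only [walkLength, endPos, Action.loc, a₂, b₂, a₃, sub_zero, abs_neg, abs_of_pos hv, e3,
      zero_sub] at this hw
    linarith
  · rw [a₂, b₂, abs_neg, abs_of_pos hv]
    exact ⟨rfl, huv⟩
  · rw [a₁, b₁, abs_of_pos hu]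
    exact ⟨rfl, le_rfl⟩

/-- For capacity one, shortest schedules for `(0, u)`, `(0, -v)` and `(-u, q)`, where `q > -u`. -/
theorem IsShortestSchedule.startsAndEnds_one {r₁ r₂ r₃ : Request} {u v q : ℝ} {S : List Action}
    (hu : 0 < u) (huv : u ≤ v) (hvu : v ≤ 2 * u) (hqu : -u < q) (hq : q < 0)
    (h₁₂ : r₁ ≠ r₂) (h₁₃ : r₁ ≠ r₃) (h₂₃ : r₂ ≠ r₃)
    (a₁ : r₁.a = 0) (b₁ : r₁.b = u) (a₂ : r₂.a = 0) (b₂ : r₂.b = -v) (a₃ : r₃.a = -u)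
    (b₃ : r₃.b = q) (hS : IsShortestSchedule 1 {r₃, r₂, r₁} 0 S) :
    StartsAndEnds u (2 * v + u) u S := by
  have hw := walkLength_triple_le le_rfl h₁₂ h₁₃ h₂₃ hu (by linarith) hqu.le hq.le
    a₁ b₁ a₂ b₂ a₃ b₃ hS
  obtain ⟨s₁, hs₁, S₁, rfl, hS₁⟩ := hS.1.exists_load_unload_cons (by simp)
  have hne : (({r₃, r₂, r₁} : Finset Request).erase s₁).Nonempty := by
    rw [← Finset.card_pos, Finset.card_erase_of_mem hs₁]
    simp [h₁₂.symm, h₁₃.symm, h₂₃.symm]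
  obtain ⟨s₂, hs₂, S₂, rfl, hS₂⟩ := hS₁.exists_load_unload_cons hne
  have hne : ((({r₃, r₂, r₁} : Finset Request).erase s₁).erase s₂).Nonempty := by
    rw [← Finset.card_pos, Finset.card_erase_of_mem hs₂, Finset.card_erase_of_mem hs₁]
    simp [h₁₂.symm, h₁₃.symm, h₂₃.symm]
  obtain ⟨s₃, hs₃, S₃, rfl, hS₃⟩ := hS₂.exists_load_unload_cons hne
  have hS₃' : S₃ = [] := by
    refine serves_empty (c := 1) ?_
    convert hS₃ using 1
    rw [eq_comm, ← Finset.card_eq_zero, Finset.card_erase_of_mem hs₃, Finset.card_erase_of_mem hs₂,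
      Finset.card_erase_of_mem hs₁]
    simp [h₁₂.symm, h₁₃.symm, h₂₃.symm]
  subst hS₃'
  have f1 : |u| = u := abs_of_pos hu
  have f2 : |v| = v := abs_of_pos (by linarith)
  have f3 : |q| = -q := abs_of_neg hq
  have e1 : |-u - -v| = v - u := by rw [abs_of_nonneg (by linarith)]; ring
  have e2 : |q - -u| = q + u := by rw [abs_of_nonneg (by linarith)]; ring
  have e3 : |-u - u| = 2 * u := by rw [abs_of_nonpos (by linarith)]; ring
  have hcases : (s₁ = r₂ ∧ s₂ = r₃ ∧ s₃ = r₁) ∨ ¬ walkLength 0 [Action.load s₁, .unload s₁,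
      .load s₂, .unload s₂, .load s₃, .unload s₃] ≤ 2 * v + u := by
    simp only [Finset.mem_erase, Finset.mem_insert, Finset.mem_singleton] at hs₁ hs₂ hs₃
    obtain ⟨n32, n31, hs₃⟩ := hs₃
    obtain ⟨n21, hs₂⟩ := hs₂
    rcases hs₁ with rfl | rfl | rfl <;> rcases hs₂ with rfl | rfl | rfl <;>
      try exact absurd rfl n21
    all_goals rcases hs₃ with rfl | rfl | rfl <;>
      first
        | exact absurd rfl n31
        | exact absurd rfl n32
        | exact Or.inl ⟨rfl, rfl, rfl⟩
        | right
          simp only [walkLength, Action.loc, a₁, b₁, a₂, b₂, a₃, b₃, sub_zero, zero_sub, abs_neg, abs_zero,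
            f1, f2, f3, e1, e2, e3]
          linarith
  rcases hcases with ⟨rfl, rfl, rfl⟩ | h
  · refine ⟨by simp [endPos, Action.loc, b₁], ?_, _, _, rfl, a₂, ?_⟩
    · simp only [walkLength, Action.loc, a₁, b₁, a₂, b₂, a₃, b₃, sub_zero, zero_sub, abs_neg, abs_zero,
        f1, f2, f3, e1, e2]
      linarith
    · rw [b₂, abs_neg, f2]
      exact huv
  · exact absurd hw h

/-- The server first serves `(0, u)`, `(0, -v)` and a third request and ends in `u`; it cannot
return when the last request appears right after it has started. -/
theorem completesAfter_of_startsAndEnds {r₁ r₂ r₃ r₄ : Request} {u ℓ y z ε O : ℝ} (hc : 1 ≤ c)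
    (hα : 0 < α) (h0 : 0 < ε) (hu : 0 < u) (hεu : 3 * ε < α * u) (hεl : ε < ℓ) (b₁ : r₁.b = u)
    (t₁ : r₁.t = ε) (t₂ : r₂.t = 2 * ε) (t₃ : r₃.t = 3 * ε) (hO : O = opt c {r₃, r₂, r₁})
    (hr₄ : r₄ = ⟨y, z, α * O + ε⟩)
    (hS : ∀ S, IsShortestSchedule c {r₃, r₂, r₁} 0 S → StartsAndEnds u ℓ u S)
    (hK : α * opt c {r₄, r₃, r₂, r₁} < α * O + 2 * u) :
    CompletesAfter α B (State.init [r₁, r₂, r₃, r₄])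
      (α * O + ℓ + (|y - u| + |z - y|)) := by
  have key : ∀ R : Finset Request, r₁ ∈ R → 3 * ε < α * opt c R := fun R hR => by
    have := abs_le_opt hc hR
    rw [b₁, abs_of_pos hu] at this
    exact hεu.trans_le (mul_le_mul_of_nonneg_left this hα.le)
  have k₁ := key {r₁} (by simp)
  have k₂ := key {r₂, r₁} (by simp)
  have k₃ := key {r₃, r₂, r₁} (by simp)
  have t₄ : r₄.t = α * O + ε := by rw [hr₄]
  rw [← hO] at k₃
  obtain ⟨hl, hlen, r, S, hr, ha, hb⟩ := hS _ (B.sched_spec {r₃, r₂, r₁} (α * O) {r₃, r₂, r₁} 0)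
  refine completesAfter_init (by linarith) (by linarith) (by simp [t₁, t₂, h0]) ?_
  refine completesAfter_wait_release (by linarith) (by linarith) (by linarith)
    (by simp [t₂, t₃]; linarith) ?_
  refine completesAfter_wait_release (by linarith) (by linarith) (by rw [← hO]; linarith)
    (by simp [t₃, t₄]; linarith) ?_
  rw [← hO]
  refine completesAfter_wait (by simp) (by simp [t₄, h0]) ?_
  refine completesAfter_idle_load subset_rfl (by rw [hO]) (by simp) (by simp [t₄, h0]) (by simp)
    hr ha ?_
  rw [hl]
  intro s U hs hf ht hH hfar
  rw [ha, sub_zero] at hfar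
  have n₄ : r₄ ∉ ({r₃, r₂, r₁} : Finset Request) := by
    simp only [Finset.mem_insert, Finset.mem_singleton, not_or]
    refine ⟨(Request.ne_of_lt ?_).symm, (Request.ne_of_lt ?_).symm, (Request.ne_of_lt ?_).symm⟩ <;>
      linarith
  refine hs.completesAfter_release hf (by linarith) (by linarith) hfar
    (by rw [hH]; linarith) (by rwa [hH]) ?_
  intro s S U hs hf ht hH' _
  refine hs.completesAfter (by simp) (by simp [hf]) ?_
  rw [hf, hH', hH]
  refine (completesAfter_idle_last (d := |y - u| + |z - y|) ?_ (by simp) fun S hS => ?_).mono ?_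
  · intro r; simp only [Finset.mem_insert]; tauto
  · have := single_le_walkLength (x := u) hS (Finset.mem_insert_self r₄ ∅)
    simpa only [hr₄] using this
  · linarith

theorem opt_triple_bounds {r₁ r₂ r₃ : Request} {u v p q ε : ℝ} (hc : 1 ≤ c) (h0 : 0 < ε)
    (hu : 0 < u) (hp : -v ≤ p) (hpq : p ≤ q) (hq : q ≤ 0) (B : TieBreaking c)
    (hr₁ : r₁ = ⟨0, u, ε⟩) (hr₂ : r₂ = ⟨0, -v, 2 * ε⟩) (hr₃ : r₃ = ⟨p, q, 3 * ε⟩)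
    (hS : ∀ S, IsShortestSchedule c {r₃, r₂, r₁} 0 S → StartsAndEnds u (2 * v + u) u S) :
    2 * v + u ≤ opt c {r₃, r₂, r₁} ∧ opt c {r₃, r₂, r₁} ≤ 2 * v + u + 3 * ε := by
  constructor
  · refine le_opt hc fun S hS' => ?_
    have h := B.sched_spec ∅ 0 {r₃, r₂, r₁} 0
    exact (hS _ h).length.trans (h.2 _ hS')
  · have h₁₂ : r₁ ≠ r₂ := Request.ne_of_lt (by rw [hr₁, hr₂]; simp only; linarith)
    have h₁₃ : r₁ ≠ r₃ := Request.ne_of_lt (by rw [hr₁, hr₃]; simp only; linarith)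
    have h₂₃ : r₂ ≠ r₃ := Request.ne_of_lt (by rw [hr₂, hr₃]; simp only; linarith)
    refine opt_le [(3 * ε, .load r₂), (v + 3 * ε, .unload r₂), (2 * v + p + 3 * ε, .load r₃),
      (2 * v + q + 3 * ε, .unload r₃), (2 * v + 3 * ε, .load r₁), (2 * v + u + 3 * ε, .unload r₁)]
      (serves_triple hc h₁₂ h₁₃ h₂₃) ?_
    refine timely_load ?_ ?_ ?_ (timely_unload ?_ ?_ (timely_load ?_ ?_ ?_
      (timely_unload ?_ ?_ (timely_load ?_ ?_ ?_ (timely_unload ?_ ?_ trivial))))) <;>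
    simp only [hr₁, hr₂, hr₃] <;> linarith

theorem isRequestSequence_four {r₁ r₂ r₃ r₄ : Request} (h₁ : 0 < r₁.t) (h₁₂ : r₁.t < r₂.t)
    (h₂₃ : r₂.t < r₃.t) (h₃₄ : r₃.t < r₄.t) : IsRequestSequence [r₁, r₂, r₃, r₄] := by
  refine ⟨?_, ?_⟩
  · simp only [List.mem_cons, List.not_mem_nil, or_false, forall_eq_or_imp, forall_eq]
    refine ⟨?_, ?_, ?_, ?_⟩ <;> linarith
  · simp only [List.pairwise_cons, List.mem_cons, List.not_mem_nil, or_false, forall_eq_or_imp,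
      forall_eq, List.Pairwise.nil, and_true, false_imp_iff, implies_true]
    refine ⟨⟨?_, ?_, ?_⟩, ⟨?_, ?_⟩, ?_⟩ <;> linarith

theorem toFinset_four (r₁ r₂ r₃ r₄ : Request) :
    [r₁, r₂, r₃, r₄].toFinset = {r₄, r₃, r₂, r₁} := by
  ext
  simp only [List.mem_toFinset, List.mem_cons, List.not_mem_nil, Finset.mem_insert,
    Finset.mem_singleton]
  tauto

theorem le_competitiveRatio_of_one_le (hc : 1 ≤ c) (hα : 1 ≤ α)
    (hα' : α ≤ 2 * Real.goldenRatio / 3) :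
    ENNReal.ofReal (1 + Real.goldenRatio) ≤ competitiveRatio α B := by
  refine le_competitiveRatio fun η hη hη1 => ?_
  obtain ⟨φ1, φ2⟩ := goldenRatio_bounds
  have φ3 := Real.goldenRatio_sq
  obtain ⟨ε, h0, hεη⟩ : ∃ ε : ℝ, 0 < ε ∧ ε = η / 20 := ⟨η / 20, by positivity, rfl⟩
  obtain ⟨r₁, hr₁⟩ : ∃ r : Request, r = ⟨0, 1, ε⟩ := ⟨_, rfl⟩
  obtain ⟨r₂, hr₂⟩ : ∃ r : Request, r = ⟨0, -1, 2 * ε⟩ := ⟨_, rfl⟩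
  obtain ⟨r₃, hr₃⟩ : ∃ r : Request, r = ⟨-1, -1 + ε, 3 * ε⟩ := ⟨_, rfl⟩
  obtain ⟨O, hO⟩ : ∃ O, O = opt c {r₃, r₂, r₁} := ⟨_, rfl⟩
  obtain ⟨r₄, hr₄⟩ : ∃ r : Request, r = ⟨-(3 * α - 2), -(3 * α - 2), α * O + ε⟩ := ⟨_, rfl⟩
  have t₁ : r₁.t = ε := by rw [hr₁]
  have t₂ : r₂.t = 2 * ε := by rw [hr₂]
  have t₃ : r₃.t = 3 * ε := by rw [hr₃]
  have t₄ : r₄.t = α * O + ε := by rw [hr₄]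
  have n₁₂ : r₁ ≠ r₂ := Request.ne_of_lt (by linarith)
  have n₁₃ : r₁ ≠ r₃ := Request.ne_of_lt (by linarith)
  have n₂₃ : r₂ ≠ r₃ := Request.ne_of_lt (by linarith)
  have hS : ∀ S, IsShortestSchedule c {r₃, r₂, r₁} 0 S → StartsAndEnds 1 (2 * 1 + 1) 1 S :=
    fun S hS => hS.startsAndEnds (q := -1 + ε) hc one_pos one_pos (by linarith) (by linarith)
      (by linarith) n₁₂ n₁₃ n₂₃ le_rfl (by rw [hr₁]) (by rw [hr₁]) (by rw [hr₂]) (by rw [hr₂])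
      (by rw [hr₃]) (by rw [hr₃])
  obtain ⟨hO1, hO2⟩ := opt_triple_bounds hc h0 one_pos le_rfl (by linarith) (by linarith) B hr₁ hr₂
    hr₃ hS
  rw [← hO] at hO1 hO2
  have hαO : 3 * α ≤ α * O := by nlinarith
  have hαO' : α * O ≤ 3 * α + 4 * ε := by nlinarith
  have hopt : opt c {r₄, r₃, r₂, r₁} ≤ 3 * α + 5 * ε := by
    have : ({r₄, r₃, r₂, r₁} : Finset Request) = {r₁, r₂, r₃, r₄} := by
      ext; simp only [Finset.mem_insert, Finset.mem_singleton]; tauto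
    rw [this]
    have n₁₄ : r₁ ≠ r₄ := Request.ne_of_lt (by linarith)
    have n₂₄ : r₂ ≠ r₄ := Request.ne_of_lt (by linarith)
    have n₃₄ : r₃ ≠ r₄ := Request.ne_of_lt (by linarith)
    refine opt_le [(3 * ε, .load r₁), (1 + 3 * ε, .unload r₁), (2 + 3 * ε, .load r₂),
      (3 + 3 * ε, .unload r₂), (3 + 3 * ε, .load r₃), (3 + 4 * ε, .unload r₃),
      (3 * α + 5 * ε, .load r₄), (3 * α + 5 * ε, .unload r₄)]
      (serves_insert hc (by simp [n₁₂, n₁₃, n₁₄]) (serves_insert hc (by simp [n₂₃, n₂₄])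
        (serves_insert hc (by simp [n₃₄]) (serves_singleton hc r₄)))) ?_
    refine timely_load ?_ ?_ ?_ (timely_unload ?_ ?_ (timely_load ?_ ?_ ?_
      (timely_unload ?_ ?_ (timely_load ?_ ?_ ?_ (timely_unload ?_ ?_ (timely_load ?_ ?_ ?_
        (timely_unload ?_ ?_ trivial))))))) <;>
    simp only [hr₁, hr₂, hr₃, hr₄] <;> linarith
  refine ⟨[r₁, r₂, r₃, r₄], isRequestSequence_four (by linarith) (by linarith) (by linarith)
    (by linarith), by simp, _, 3 * α + 5 * ε, by linarith, by rwa [toFinset_four], ?_,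
    completesAfter_of_startsAndEnds hc (by linarith) h0 one_pos (by linarith) (by linarith)
      (by rw [hr₁]) t₁ t₂ t₃ hO hr₄ hS ?_⟩
  · rw [abs_of_nonpos (by linarith), sub_self, abs_zero]
    have : Real.goldenRatio * (3 * α) ≤ 3 * α + 2 := by nlinarith
    nlinarith
  · have := mul_le_mul_of_nonneg_left hopt (by linarith : 0 ≤ α)
    nlinarith

theorem le_competitiveRatio_of_lt_one (hc : 1 ≤ c) (hα : 3 * Real.goldenRatio - 4 ≤ α)
    (hα' : α < 1) : ENNReal.ofReal (1 + Real.goldenRatio) ≤ competitiveRatio α B := by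
  refine le_competitiveRatio fun η hη hη1 => ?_
  obtain ⟨φ1, φ2⟩ := goldenRatio_bounds
  obtain ⟨ε, h0, hεη⟩ : ∃ ε : ℝ, 0 < ε ∧ ε = η / 20 := ⟨η / 20, by positivity, rfl⟩
  obtain ⟨u, hu⟩ : ∃ u, u = 2 * α - 1 := ⟨_, rfl⟩
  obtain ⟨v, hv⟩ : ∃ v, v = 2 - α := ⟨_, rfl⟩
  obtain ⟨p, hp⟩ : ∃ p, p = if c = 1 then -u else -v := ⟨_, rfl⟩
  have hpv : -v ≤ p := by rw [hp]; split_ifs <;> linarith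
  have hpu : p ≤ -u := by rw [hp]; split_ifs <;> linarith
  obtain ⟨r₁, hr₁⟩ : ∃ r : Request, r = ⟨0, u, ε⟩ := ⟨_, rfl⟩
  obtain ⟨r₂, hr₂⟩ : ∃ r : Request, r = ⟨0, -v, 2 * ε⟩ := ⟨_, rfl⟩
  obtain ⟨r₃, hr₃⟩ : ∃ r : Request, r = ⟨p, -u + ε, 3 * ε⟩ := ⟨_, rfl⟩
  obtain ⟨O, hO⟩ : ∃ O, O = opt c {r₃, r₂, r₁} := ⟨_, rfl⟩
  obtain ⟨r₄, hr₄⟩ : ∃ r : Request, r = ⟨-v, -u, α * O + ε⟩ := ⟨_, rfl⟩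
  have t₁ : r₁.t = ε := by rw [hr₁]
  have t₂ : r₂.t = 2 * ε := by rw [hr₂]
  have t₃ : r₃.t = 3 * ε := by rw [hr₃]
  have t₄ : r₄.t = α * O + ε := by rw [hr₄]
  have n₁₂ : r₁ ≠ r₂ := Request.ne_of_lt (by linarith)
  have n₁₃ : r₁ ≠ r₃ := Request.ne_of_lt (by linarith)
  have n₂₃ : r₂ ≠ r₃ := Request.ne_of_lt (by linarith)
  have hS : ∀ S, IsShortestSchedule c {r₃, r₂, r₁} 0 S → StartsAndEnds u (2 * v + u) u S := by
    intro S hS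
    by_cases h1 : c = 1
    · subst h1
      refine hS.startsAndEnds_one (q := -u + ε) (by linarith) (by linarith) (by linarith)
        (by linarith) (by linarith) n₁₂ n₁₃ n₂₃ (by rw [hr₁]) (by rw [hr₁]) (by rw [hr₂])
        (by rw [hr₂]) (by rw [hr₃, hp]; simp) (by rw [hr₃])
    · refine hS.startsAndEnds (q := -u + ε) hc (by linarith) (by linarith) (by linarith)
        (by linarith) (by linarith) n₁₂ n₁₃ n₂₃ (by linarith) (by rw [hr₁]) (by rw [hr₁])
        (by rw [hr₂]) (by rw [hr₂]) (by rw [hr₃, hp]; simp [h1]) (by rw [hr₃])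
  obtain ⟨hO1, hO2⟩ := opt_triple_bounds hc h0 (by linarith) hpv (by linarith) (by linarith) B
    hr₁ hr₂ hr₃ hS
  rw [← hO] at hO1 hO2
  have hαO : 3 * α ≤ α * O := by nlinarith
  have hαO' : α * O ≤ 3 * α + 3 * ε := by nlinarith
  have hopt : opt c {r₄, r₃, r₂, r₁} ≤ 3 + 5 * ε := by
    have n₁₄ : r₁ ≠ r₄ := Request.ne_of_lt (by linarith)
    have n₂₄ : r₂ ≠ r₄ := Request.ne_of_lt (by linarith)
    have n₃₄ : r₃ ≠ r₄ := Request.ne_of_lt (by linarith)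
    have : ({r₄, r₃, r₂, r₁} : Finset Request) = {r₁, r₂, r₄, r₃} := by
      ext; simp only [Finset.mem_insert, Finset.mem_singleton]; tauto
    rw [this]
    by_cases h1 : c = 1
    · have hpu' : p = -u := by rw [hp, if_pos h1]
      refine opt_le [(3 * ε, .load r₁), (u + 3 * ε, .unload r₁), (2 * u + 3 * ε, .load r₂),
        (3 * α + 3 * ε, .unload r₂), (3 * α + 4 * ε, .load r₄), (3 + 4 * ε, .unload r₄),
        (3 + 4 * ε, .load r₃), (3 + 5 * ε, .unload r₃)]
        (serves_insert hc (by simp [n₁₂, n₁₃, n₁₄]) (serves_insert hc (by simp [n₂₃, n₂₄])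
          (serves_insert hc (by simp [n₃₄.symm]) (serves_singleton hc r₃)))) ?_
      refine timely_load ?_ ?_ ?_ (timely_unload ?_ ?_ (timely_load ?_ ?_ ?_
        (timely_unload ?_ ?_ (timely_load ?_ ?_ ?_ (timely_unload ?_ ?_ (timely_load ?_ ?_ ?_
          (timely_unload ?_ ?_ trivial))))))) <;>
      simp only [hr₁, hr₂, hr₃, hr₄] <;> linarith
    · have hpv' : p = -v := by rw [hp, if_neg h1]
      have hc2 : 2 ≤ c := by
        rw [← one_add_one_eq_two]
        exact Order.add_one_le_of_lt (lt_of_le_of_ne hc (Ne.symm h1))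
      refine opt_le [(3 * ε, .load r₁), (u + 3 * ε, .unload r₁), (2 * u + 3 * ε, .load r₂),
        (3 * α + 3 * ε, .unload r₂), (3 * α + 4 * ε, .load r₄), (3 * α + 4 * ε, .load r₃),
        (3 + 4 * ε, .unload r₄), (3 + 5 * ε, .unload r₃)]
        (serves_insert hc (by simp [n₁₂, n₁₃, n₁₄]) (serves_insert hc (by simp [n₂₃, n₂₄])
          (serves_pair hc2 n₃₄.symm))) ?_
      refine timely_load ?_ ?_ ?_ (timely_unload ?_ ?_ (timely_load ?_ ?_ ?_
        (timely_unload ?_ ?_ (timely_load ?_ ?_ ?_ (timely_load ?_ ?_ ?_ (timely_unload ?_ ?_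
          (timely_unload ?_ ?_ trivial))))))) <;>
      simp only [hr₁, hr₂, hr₃, hr₄] <;> linarith
  refine ⟨[r₁, r₂, r₃, r₄], isRequestSequence_four (by linarith) (by linarith) (by linarith)
    (by linarith), by simp, _, 3 + 5 * ε, by linarith, by rwa [toFinset_four], ?_,
    completesAfter_of_startsAndEnds hc (by linarith) h0 (by linarith) (by nlinarith) (by linarith)
      (by rw [hr₁]) t₁ t₂ t₃ hO hr₄ hS ?_⟩
  · rw [abs_of_nonpos (by linarith), abs_of_nonneg (by linarith)]
    nlinarith
  · have := mul_le_mul_of_nonneg_left hopt (by linarith : 0 ≤ α)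
    nlinarith

end DialARide

theorem corollary2 (c : ℕ∞) (hc : 1 ≤ c) (α : ℝ) (hα : 0 ≤ α)
    (hα' : α ∉ Set.Ioo (2 * Real.goldenRatio / 3) Real.goldenRatio)
    (B : DialARide.TieBreaking c) :
    ENNReal.ofReal (1 + Real.goldenRatio) ≤ DialARide.competitiveRatio α B := by
  rcases hα.eq_or_lt with rfl | h0
  · exact DialARide.le_competitiveRatio_zero hc B
  rcases le_or_gt α (3 * Real.goldenRatio - 4) with h1 | h1
  · exact DialARide.le_competitiveRatio_of_le hc h0 h1
  rcases lt_or_ge α 1 with h2 | h2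
  · exact DialARide.le_competitiveRatio_of_lt_one hc h1.le h2
  rcases le_or_gt α (2 * Real.goldenRatio / 3) with h3 | h3
  · exact DialARide.le_competitiveRatio_of_one_le hc h2 h3
  · exact DialARide.le_competitiveRatio_of_goldenRatio_le hc
      (not_lt.1 fun h4 => hα' ⟨h3, h4⟩)
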